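/- Let $\alpha>0$ and $\mathcal I=(0,1)$. Let $\mathcal H:=W_0^{1,2}(\mathcal I)\times L^2(\mathcal I)$ (complex-valued functions) be the Hilbert space with inner product $\langle(\phi_1,\phi_2),(\psi_1,\psi_2)\rangle_{\mathcal H}:=\langle\phi_1',\psi_1'\rangle_{L^2}+\langle\phi_2,\psi_2\rangle_{L^2}$, and let $G_0$ be the operator in $\mathcal H$ given by $$G_0(u,v):=\Bigl(v,\;u''-\frac{2\alpha}{x}\,v\Bigr),\qquad \operatorname{Dom}(G_0):=\bigl(W_0^{1,2}(\mathcal I)\cap W^{2,2}(\mathcal I)\bigr)^2 .$$ For $\lambda\in\mathbb C$ let $T(\lambda)$ be the operator in $L^2(\mathcal I)$ given by $$T(\lambda):=-\frac{d^2}{dx^2}+\frac{2\lambda\alpha}{x}+\lambda^2,\qquad \operatorname{Dom}(T(\lambda)):=W_0^{1,2}(\mathcal I)\cap W^{2,2}(\mathcal I).$$ Then $G_0$ is closable, and its closure $G:=\overline{G_0}$ in $\mathcal H$ satisfies: (i) $G$ generates a (strongly continuous) contraction semigroup in $\mathcal H$; (ii) for every $\lambda\in\mathbb C$, $\lambda\in\sigma(G)$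 if and only if $0\in\sigma(T(\lambda))$; (iii) the spectrum of $G$ is discrete, i.e. every $\lambda\in\sigma(G)$ is an isolated point of $\sigma(G)$ and an eigenvalue of $G$ of finite algebraic multiplicity (the Riesz projection of $G$ at $\lambda$ has finite rank). -/

import Mathlib

open MeasureTheory Filter Topology Set
open scoped NNReal ENNReal ContDiff ComplexConjugate InnerProductSpace

noncomputable section

namespace DampedWave

/-! ## Function spaces on the interval `(0, 1)` -/

/-- Lebesgue measure on `(0, 1)`. -/
abbrev muI : Measure ℝ := volume.restrict (Ioo (0 : ℝ) 1)

/-- The complex Hilbert space `L²(0, 1)`. -/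
abbrev L2 : Type := Lp ℂ 2 muI

/-- Complex-valued test functions on `(0, 1)`, i.e. elements of `C_c^∞((0, 1))`. -/
structure IsTestFun (φ : ℝ → ℂ) : Prop where
  smooth : ContDiff ℝ ∞ φ
  compact : HasCompactSupport φ
  supp : tsupport φ ⊆ Ioo (0 : ℝ) 1

/-- `g ∈ L²` is a weak derivative of `f ∈ L²` on `(0, 1)`. -/
def HasWeakDeriv (f g : L2) : Prop :=
  ∀ φ : ℝ → ℂ, IsTestFun φ →
    ∫ x in Ioo (0 : ℝ) 1, f x * deriv φ x = - ∫ x in Ioo (0 : ℝ) 1, g x * φ x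

namespace IsTestFun

variable {φ ψ : ℝ → ℂ}

lemma add (h : IsTestFun φ) (h2 : IsTestFun ψ) : IsTestFun (φ + ψ) :=
  ⟨h.smooth.add h2.smooth, h.compact.add h2.compact,
    (tsupport_add φ ψ).trans (union_subset h.supp h2.supp)⟩

lemma smul (c : ℂ) (h : IsTestFun φ) : IsTestFun (c • φ) :=
  ⟨contDiff_const.smul h.smooth, h.compact.smul_left (f := fun _ => c),
    (tsupport_smul_subset_right (fun _ => c) φ).trans h.supp⟩

lemma zero : IsTestFun 0 :=
  ⟨contDiff_const, HasCompactSupport.zero, by simp [tsupport]⟩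

lemma differentiable (h : IsTestFun φ) : Differentiable ℝ φ := h.smooth.differentiable (by simp)

lemma deriv (h : IsTestFun φ) : IsTestFun (deriv φ) :=
  ⟨((contDiff_infty_iff_deriv (𝕜 := ℝ)).1 h.smooth).2, h.compact.deriv,
    (closure_minimal (support_deriv_subset) (isClosed_tsupport φ)).trans h.supp⟩

lemma memLp (h : IsTestFun φ) : MemLp φ 2 muI :=
  (h.smooth.continuous.memLp_of_hasCompactSupport h.compact).restrict _

/-- A test function vanishes near every point outside `(0, 1)`. -/
lemma eventually_zero (h : IsTestFun φ) {x : ℝ} (hx : x ∉ Ioo (0 : ℝ) 1) : φ =ᶠ[𝓝 x] 0 :=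
  notMem_tsupport_iff_eventuallyEq.1 fun h' => hx (h.supp h')

lemma eq_zero (h : IsTestFun φ) {x : ℝ} (hx : x ∉ Ioo (0 : ℝ) 1) : φ x = 0 :=
  (h.eventually_zero hx).eq_of_nhds

lemma mul (h : IsTestFun φ) (h2 : IsTestFun ψ) : IsTestFun (φ * ψ) :=
  ⟨h.smooth.mul h2.smooth, h.compact.mul_right,
    (tsupport_mul_subset_left).trans h.supp⟩

end IsTestFun

lemma integral_deriv_test {φ : ℝ → ℂ} (h : IsTestFun φ) :
    ∫ x in Ioo (0 : ℝ) 1, deriv φ x = 0 := by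
  rw [← integral_Ioc_eq_integral_Ioo, ← intervalIntegral.integral_of_le zero_le_one,
    intervalIntegral.integral_deriv_eq_sub (fun x _ => h.differentiable x)
      (h.deriv.smooth.continuous.intervalIntegrable _ _), h.eq_zero (by simp), h.eq_zero (by simp),
    sub_zero]

lemma integrable_mul_test (f : L2) {φ : ℝ → ℂ} (h : IsTestFun φ) :
    Integrable (fun x => f x * φ x) muI :=
  (Lp.memLp f).integrable_mul h.memLp

/-- The pairing with a test function, as an inner product. -/
lemma integral_mul_test (f : L2) {φ : ℝ → ℂ} (h : MemLp (fun x => conj (φ x)) 2 muI) :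
    ∫ x in Ioo (0 : ℝ) 1, f x * φ x = ⟪h.toLp _, f⟫_ℂ := by
  rw [L2.inner_def]
  refine integral_congr_ae ?_
  filter_upwards [h.coeFn_toLp] with x hx
  rw [hx]
  simp

lemma continuous_pairing {φ : ℝ → ℂ} (h : IsTestFun φ) :
    Continuous fun f : L2 => ∫ x in Ioo (0 : ℝ) 1, f x * φ x := by
  have h' : MemLp (fun x => conj (φ x)) 2 muI := h.memLp.star
  simp_rw [fun f : L2 => integral_mul_test f h']
  fun_prop

lemma HasWeakDeriv.add {f g f' g' : L2} (h : HasWeakDeriv f g) (h' : HasWeakDeriv f' g') :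
    HasWeakDeriv (f + f') (g + g') := by
  intro φ hφ
  have e1 : ∀ {ψ : ℝ → ℂ}, IsTestFun ψ → ∀ a b : L2,
      ∫ x in Ioo (0 : ℝ) 1, (a + b : L2) x * ψ x
        = (∫ x in Ioo (0 : ℝ) 1, a x * ψ x) + ∫ x in Ioo (0 : ℝ) 1, b x * ψ x := by
    intro ψ hψ a b
    rw [← integral_add (integrable_mul_test a hψ) (integrable_mul_test b hψ)]
    refine integral_congr_ae ?_
    filter_upwards [Lp.coeFn_add a b] with x hx
    rw [hx, Pi.add_apply, add_mul]
  rw [e1 hφ.deriv, e1 hφ, h φ hφ, h' φ hφ]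
  ring

lemma HasWeakDeriv.smul {f g : L2} (c : ℂ) (h : HasWeakDeriv f g) :
    HasWeakDeriv (c • f) (c • g) := by
  intro φ hφ
  have e1 : ∀ (ψ : ℝ → ℂ) (a : L2),
      ∫ x in Ioo (0 : ℝ) 1, (c • a : L2) x * ψ x = c * ∫ x in Ioo (0 : ℝ) 1, a x * ψ x := by
    intro ψ a
    rw [← integral_const_mul]
    refine integral_congr_ae ?_
    filter_upwards [Lp.coeFn_smul c a] with x hx
    rw [hx, Pi.smul_apply, smul_eq_mul, mul_assoc]
  rw [e1, e1, h φ hφ]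
  ring

lemma HasWeakDeriv.zero : HasWeakDeriv 0 0 := by
  simpa using HasWeakDeriv.smul 0 (f := 0) (g := 0)
    (by
      intro φ hφ
      have e1 : ∀ (ψ : ℝ → ℂ), ∫ x in Ioo (0 : ℝ) 1, (0 : L2) x * ψ x = 0 := by
        intro ψ
        rw [← integral_zero ℝ ℂ (μ := muI)]
        refine integral_congr_ae ?_
        filter_upwards [Lp.coeFn_zero ℂ 2 muI] with x hx
        rw [hx]; simp
      rw [e1, e1, neg_zero])

/-- Weak derivatives are unique. -/
lemma HasWeakDeriv.unique {f g g' : L2} (h : HasWeakDeriv f g) (h' : HasWeakDeriv f g') :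
    g = g' := by
  have key : HasWeakDeriv 0 (g - g') := by
    have := h.add (h'.smul (-1))
    simpa [sub_eq_add_neg] using this
  have hz : ∀ᵐ x ∂volume, x ∈ Ioo (0 : ℝ) 1 → (g - g' : L2) x = 0 := by
    refine isOpen_Ioo.ae_eq_zero_of_integral_contDiff_smul_eq_zero ?_ ?_
    · refine IntegrableOn.locallyIntegrableOn ?_
      exact (Lp.memLp (g - g')).integrable (by norm_num)
    · intro θ hθ hc hs
      have hT : IsTestFun (fun x => (θ x : ℂ)) := by
        refine ⟨Complex.ofRealCLM.contDiff.comp hθ, hc.comp_left (g := Complex.ofReal) (by simp), ?_⟩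
        exact (tsupport_comp_subset (g := Complex.ofReal) (by simp) θ).trans hs
      have h1 := key _ hT
      have h2 : ∫ x in Ioo (0 : ℝ) 1, (0 : L2) x * _root_.deriv (fun x => (θ x : ℂ)) x = 0 := by
        rw [← integral_zero ℝ ℂ (μ := muI)]
        refine integral_congr_ae ?_
        filter_upwards [Lp.coeFn_zero ℂ 2 muI] with x hx
        rw [hx]; simp
      rw [h2, eq_comm, neg_eq_zero] at h1
      rw [← setIntegral_eq_integral_of_forall_compl_eq_zero (s := Ioo (0 : ℝ) 1), ← h1]
      · refine integral_congr_ae (Eventually.of_forall fun x => ?_)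
        simp [mul_comm]
      · intro x hx
        have := image_eq_zero_of_notMem_tsupport (fun h' => hx (hs h') : x ∉ tsupport θ)
        simp [this]
  have : g - g' = 0 := by
    rw [Lp.eq_zero_iff_ae_eq_zero]
    exact (ae_restrict_iff' measurableSet_Ioo).2 hz
  exact sub_eq_zero.1 this

/-- The Sobolev space `W^{1,2}(0, 1)`, as a subspace of `L²(0, 1)`. -/
def W12 : Submodule ℂ L2 where
  carrier := {f | ∃ g, HasWeakDeriv f g}
  zero_mem' := ⟨0, HasWeakDeriv.zero⟩
  add_mem' := fun ⟨g, hg⟩ ⟨g', hg'⟩ => ⟨g + g', hg.add hg'⟩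
  smul_mem' := fun c _ ⟨g, hg⟩ => ⟨c • g, hg.smul c⟩

lemma HasWeakDeriv.mem {f g : L2} (h : HasWeakDeriv f g) : f ∈ W12 := ⟨g, h⟩

/-- The weak derivative `f ↦ f'`, from `W^{1,2}(0, 1)` to `L²(0, 1)`. -/
def weakDeriv : W12 →ₗ[ℂ] L2 where
  toFun f := f.2.choose
  map_add' f g := (f + g).2.choose_spec.unique (f.2.choose_spec.add g.2.choose_spec)
  map_smul' c f := (c • f).2.choose_spec.unique (f.2.choose_spec.smul c)

lemma hasWeakDeriv_weakDeriv (f : W12) : HasWeakDeriv f (weakDeriv f) := f.2.choose_spec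

lemma weakDeriv_eq {f g : L2} (h : HasWeakDeriv f g) : weakDeriv ⟨f, h.mem⟩ = g :=
  (hasWeakDeriv_weakDeriv ⟨f, h.mem⟩).unique h

/-- The Sobolev space `W^{2,2}(0, 1)`: those `f ∈ W^{1,2}` with `f' ∈ W^{1,2}`. -/
def W22 : Submodule ℂ L2 := (W12.comap weakDeriv).map W12.subtype

lemma W22_le_W12 : W22 ≤ W12 := by
  rintro f ⟨g, -, rfl⟩
  exact g.2

lemma weakDeriv_mem_of_W22 (f : W22) : weakDeriv ⟨f, W22_le_W12 f.2⟩ ∈ W12 := by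
  obtain ⟨f, g, hg, rfl⟩ := f
  exact hg

/-- The second weak derivative `f ↦ f''`, from `W^{2,2}(0, 1)` to `L²(0, 1)`. -/
def weakDeriv₂ : W22 →ₗ[ℂ] L2 :=
  weakDeriv ∘ₗ (weakDeriv ∘ₗ Submodule.inclusion W22_le_W12).codRestrict W12 weakDeriv_mem_of_W22

/-- The pairs `(φ, φ')` with `φ ∈ C_c^∞((0, 1))`, in `L² × L²`. -/
def testPairs : Submodule ℂ (L2 × L2) where
  carrier := {p | ∃ φ : ℝ → ℂ, IsTestFun φ ∧ p.1 =ᵐ[muI] φ ∧ p.2 =ᵐ[muI] deriv φ}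
  zero_mem' := ⟨0, IsTestFun.zero, Lp.coeFn_zero ℂ 2 muI, by
    have : deriv (0 : ℝ → ℂ) = 0 := by ext; simp
    rw [this]; exact Lp.coeFn_zero ℂ 2 muI⟩
  add_mem' := by
    rintro p q ⟨φ, hφ, h1, h2⟩ ⟨ψ, hψ, h3, h4⟩
    refine ⟨φ + ψ, hφ.add hψ, (Lp.coeFn_add p.1 q.1).trans (h1.add h3),
      (Lp.coeFn_add p.2 q.2).trans ((h2.add h4).trans (Eventually.of_forall fun x => ?_))⟩
    exact (deriv_add (hφ.differentiable x) (hψ.differentiable x)).symm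
  smul_mem' := by
    rintro c p ⟨φ, hφ, h1, h2⟩
    refine ⟨c • φ, hφ.smul c, (Lp.coeFn_smul c p.1).trans (h1.const_smul c),
      (Lp.coeFn_smul c p.2).trans ((h2.const_smul c).trans (Eventually.of_forall fun x => ?_))⟩
    exact (deriv_const_smul c (hφ.differentiable x)).symm

/-- Limits in `L² × L²` of pairs `(φ, φ')` are of the form `(f, f')`. -/
lemma hasWeakDeriv_of_mem_closure {p : L2 × L2} (hp : p ∈ testPairs.topologicalClosure) :
    HasWeakDeriv p.1 p.2 := by
  intro φ hφ
  have hcl : IsClosed {p : L2 × L2 | ∫ x in Ioo (0 : ℝ) 1, p.1 x * deriv φ x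
      = - ∫ x in Ioo (0 : ℝ) 1, p.2 x * φ x} :=
    isClosed_eq ((continuous_pairing hφ.deriv).comp continuous_fst)
      ((continuous_pairing hφ).comp continuous_snd).neg
  refine hcl.closure_subset_iff.2 ?_ hp
  rintro q ⟨ψ, hψ, h1, h2⟩
  change _ = _
  rw [eq_neg_iff_add_eq_zero,
    ← integral_add (integrable_mul_test _ hφ.deriv) (integrable_mul_test _ hφ),
    ← integral_deriv_test (hψ.mul hφ)]
  refine integral_congr_ae ?_
  filter_upwards [h1, h2] with x h1 h2
  rw [h1, h2, deriv_mul (hψ.differentiable x) (hφ.differentiable x)]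
  ring

/-- `W_0^{1,2}(0, 1)`: the closure of `C_c^∞((0, 1))` in `W^{1,2}(0, 1)`, i.e. the `f ∈ W^{1,2}`
such that `(f, f')` is a limit in `L² × L²` of pairs `(φ, φ')` with `φ ∈ C_c^∞((0, 1))`. -/
def W012 : Submodule ℂ L2 :=
  (testPairs.topologicalClosure.comap (LinearMap.prod W12.subtype weakDeriv)).map W12.subtype

lemma W012_le_W12 : W012 ≤ W12 := by
  rintro f ⟨g, -, rfl⟩
  exact g.2

lemma mem_W012_iff {f : L2} :
    f ∈ W012 ↔ ∃ g, HasWeakDeriv f g ∧ (f, g) ∈ testPairs.topologicalClosure := by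
  constructor
  · rintro ⟨g, hg, rfl⟩
    exact ⟨weakDeriv g, hasWeakDeriv_weakDeriv g, hg⟩
  · rintro ⟨g, hg, h⟩
    refine ⟨⟨f, hg.mem⟩, ?_, rfl⟩
    rw [SetLike.mem_coe, Submodule.mem_comap]
    simpa [weakDeriv_eq hg] using h

/-- The weak derivative on `W_0^{1,2}(0, 1)`. -/
def weakDeriv₀ : W012 →ₗ[ℂ] L2 := weakDeriv ∘ₗ Submodule.inclusion W012_le_W12

lemma hasWeakDeriv_weakDeriv₀ (f : W012) : HasWeakDeriv f (weakDeriv₀ f) :=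
  hasWeakDeriv_weakDeriv ⟨f, W012_le_W12 f.2⟩

lemma mem_closure_of_W012 (f : W012) :
    ((f : L2), weakDeriv₀ f) ∈ testPairs.topologicalClosure := by
  obtain ⟨g, hg, h⟩ := mem_W012_iff.1 f.2
  rwa [(hasWeakDeriv_weakDeriv₀ f).unique hg]

/-! ## Hardy's inequality: `v / x ∈ L²` for `v ∈ W_0^{1,2}` -/

lemma test_div_continuous {φ : ℝ → ℂ} (h : IsTestFun φ) : Continuous fun x => φ x / (x : ℂ) := by
  rw [continuous_iff_continuousAt]
  intro x
  by_cases hx : x = 0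
  · subst hx
    have : (fun x => φ x / (x : ℂ)) =ᶠ[𝓝 0] fun _ => 0 := by
      filter_upwards [h.eventually_zero (x := 0) (by simp)] with y hy
      simp [hy]
    exact continuousAt_const.congr this.symm
  · exact h.smooth.continuous.continuousAt.div Complex.continuous_ofReal.continuousAt
      (by exact_mod_cast hx)

lemma hasDerivAt_normSq_div {φ : ℝ → ℂ} (h : IsTestFun φ) (x : ℝ) :
    HasDerivAt (fun x => - (‖φ x‖ ^ 2 / x))
      (‖φ x / (x : ℂ)‖ ^ 2 - 2 * inner ℝ (φ x / (x : ℂ)) (deriv φ x)) x := by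
  by_cases hx : x = 0
  · subst hx
    have e : (fun x => - (‖φ x‖ ^ 2 / x)) =ᶠ[𝓝 0] fun _ => 0 := by
      filter_upwards [h.eventually_zero (x := 0) (by simp)] with y hy
      simp [hy]
    simpa using (hasDerivAt_const (0 : ℝ) (0 : ℝ)).congr_of_eventuallyEq e
  · have h1 : HasDerivAt (fun x => ‖φ x‖ ^ 2) (2 * inner ℝ (φ x) (deriv φ x)) x :=
      (h.differentiable x).hasDerivAt.norm_sq
    have h2 := (h1.div (hasDerivAt_id x) hx).neg
    refine h2.congr_deriv ?_
    have e1 : φ x / (x : ℂ) = (x⁻¹ : ℝ) • φ x := by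
      rw [Complex.real_smul]; push_cast; ring
    rw [e1, real_inner_smul_left, norm_smul, mul_pow, Real.norm_eq_abs, sq_abs]
    simp only [id]
    field_simp
    ring

/-- Hardy's inequality for test functions. -/
lemma hardy_test {φ : ℝ → ℂ} (h : IsTestFun φ) :
    ∫ x in Ioo (0 : ℝ) 1, ‖φ x / (x : ℂ)‖ ^ 2 ≤ 4 * ∫ x in Ioo (0 : ℝ) 1, ‖deriv φ x‖ ^ 2 := by
  have c1 := test_div_continuous h
  have c2 := h.deriv.smooth.continuous
  have hint : ∀ {F : ℝ → ℝ}, Continuous F → Integrable F muI := fun hF =>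
    (hF.integrableOn_Icc (a := 0) (b := 1)).mono_set Ioo_subset_Icc_self
  have cF : Continuous fun x => ‖φ x / (x : ℂ)‖ ^ 2 - 2 * inner ℝ (φ x / (x : ℂ)) (deriv φ x) :=
    (c1.norm.pow 2).sub (continuous_const.mul (c1.inner c2))
  have hF : ∫ x in Ioo (0 : ℝ) 1,
      (‖φ x / (x : ℂ)‖ ^ 2 - 2 * inner ℝ (φ x / (x : ℂ)) (deriv φ x)) = 0 := by
    rw [← integral_Ioc_eq_integral_Ioo, ← intervalIntegral.integral_of_le zero_le_one,
      intervalIntegral.integral_eq_sub_of_hasDerivAt (fun x _ => hasDerivAt_normSq_div h x)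
        (cF.intervalIntegrable _ _), h.eq_zero (x := 0) (by simp), h.eq_zero (x := 1) (by simp)]
    simp
  have key : ∫ x in Ioo (0 : ℝ) 1, ‖φ x / (x : ℂ)‖ ^ 2 ≤ ∫ x in Ioo (0 : ℝ) 1,
      (4 * ‖deriv φ x‖ ^ 2 +
        2 * (‖φ x / (x : ℂ)‖ ^ 2 - 2 * inner ℝ (φ x / (x : ℂ)) (deriv φ x))) := by
    refine integral_mono (hint (c1.norm.pow 2))
      (hint ((continuous_const.mul (c2.norm.pow 2)).add (continuous_const.mul cF))) fun x => ?_
    have := sq_nonneg ‖φ x / (x : ℂ) - (2 : ℝ) • deriv φ x‖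
    rw [norm_sub_sq_real, real_inner_smul_right, norm_smul] at this
    norm_num [mul_pow] at this ⊢
    linarith
  have i1 : Integrable (fun x => 4 * ‖deriv φ x‖ ^ 2) muI :=
    hint (continuous_const.mul (c2.norm.pow 2))
  have i2 : Integrable (fun x => 2 * (‖φ x / (x : ℂ)‖ ^ 2
      - 2 * inner ℝ (φ x / (x : ℂ)) (deriv φ x))) muI := hint (continuous_const.mul cF)
  rw [integral_add i1 i2, integral_const_mul, integral_const_mul, hF] at key
  linarith

lemma hardy_test_eLpNorm {φ : ℝ → ℂ} (h : IsTestFun φ) :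
    eLpNorm (fun x => φ x / (x : ℂ)) 2 muI ≤ 2 * eLpNorm (deriv φ) 2 muI := by
  have c1 := test_div_continuous h
  have m1 : MemLp (fun x => φ x / (x : ℂ)) 2 muI := by
    refine MemLp.restrict _ (c1.memLp_of_hasCompactSupport ?_)
    exact h.compact.mul_right (f' := fun x : ℝ => ((x : ℂ))⁻¹)
  have m2 := h.deriv.memLp
  rw [m1.eLpNorm_eq_integral_rpow_norm (by norm_num) (by norm_num),
    m2.eLpNorm_eq_integral_rpow_norm (by norm_num) (by norm_num)]
  have : (2 : ℝ≥0∞) = ENNReal.ofReal 2 := by simp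
  rw [this, ← ENNReal.ofReal_mul (by norm_num)]
  refine ENNReal.ofReal_le_ofReal ?_
  simp only [ENNReal.toReal_ofReal (show (0 : ℝ) ≤ 2 by norm_num), Real.rpow_two,
    ← one_div, ← Real.sqrt_eq_rpow]
  rw [show (2 : ℝ) = √4 by rw [show (4 : ℝ) = 2 ^ 2 by norm_num]; simp,
    ← Real.sqrt_mul (by norm_num)]
  exact Real.sqrt_le_sqrt (by simpa using hardy_test h)

/-- Hardy's inequality on `W_0^{1,2}(0, 1)`. -/
lemma hardy_closure {p : L2 × L2} (hp : p ∈ testPairs.topologicalClosure) :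
    eLpNorm (fun x => p.1 x / (x : ℂ)) 2 muI ≤ 2 * eLpNorm p.2 2 muI := by
  obtain ⟨q, hq, hlim⟩ := mem_closure_iff_seq_limit.1 hp
  have l1 : Tendsto (fun n => (q n).1) atTop (𝓝 p.1) := (continuous_fst.tendsto p).comp hlim
  have l2 : Tendsto (fun n => (q n).2) atTop (𝓝 p.2) := (continuous_snd.tendsto p).comp hlim
  obtain ⟨ns, hns, hae⟩ := (tendstoInMeasure_of_tendsto_Lp l1).exists_seq_tendsto_ae
  have hm : ∀ f : L2, AEStronglyMeasurable (fun x => f x / (x : ℂ)) muI := fun f =>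
    (Lp.aestronglyMeasurable f).div₀ Complex.measurable_ofReal.aestronglyMeasurable
  have step := Lp.eLpNorm_lim_le_liminf_eLpNorm (p := 2) (μ := muI)
    (f := fun n x => (q (ns n)).1 x / (x : ℂ)) (fun n => hm _)
    (fun x => p.1 x / (x : ℂ)) (by
      filter_upwards [hae] with x hx
      exact hx.div_const _)
  refine step.trans ?_
  have hb : ∀ n, eLpNorm (fun x => (q (ns n)).1 x / (x : ℂ)) 2 muI ≤ 2 * ‖(q (ns n)).2‖ₑ := by
    intro n
    obtain ⟨φ, hφ, h1, h2⟩ := hq (ns n)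
    rw [Lp.enorm_def, eLpNorm_congr_ae h2,
      eLpNorm_congr_ae (g := fun x => φ x / (x : ℂ)) (by filter_upwards [h1] with x hx; rw [hx])]
    exact hardy_test_eLpNorm hφ
  have hl : Tendsto (fun n => 2 * ‖(q (ns n)).2‖ₑ) atTop (𝓝 (2 * eLpNorm p.2 2 muI)) := by
    rw [← Lp.enorm_def]
    refine ENNReal.Tendsto.const_mul ?_ (Or.inr (by norm_num))
    exact (continuous_enorm.tendsto _).comp (l2.comp hns.tendsto_atTop)
  rw [← hl.liminf_eq]
  exact liminf_le_liminf (Eventually.of_forall hb)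

lemma memLp_div (f : W012) : MemLp (fun x => (f : L2) x / (x : ℂ)) 2 muI := by
  refine ⟨(Lp.aestronglyMeasurable _).div₀ Complex.measurable_ofReal.aestronglyMeasurable, ?_⟩
  refine (hardy_closure (mem_closure_of_W012 f)).trans_lt ?_
  exact ENNReal.mul_lt_top (by simp) (Lp.memLp _).2

/-- Multiplication by the singular function `1 / x`, from `W_0^{1,2}(0, 1)` to `L²(0, 1)`. -/
def divX : W012 →ₗ[ℂ] L2 where
  toFun f := (memLp_div f).toLp _
  map_add' f g := by
    rw [← MemLp.toLp_add]
    refine MemLp.toLp_congr _ _ ?_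
    filter_upwards [Lp.coeFn_add (f : L2) (g : L2)] with x hx
    simp only [Submodule.coe_add, Pi.add_apply]
    rw [hx, Pi.add_apply, add_div]
  map_smul' c f := by
    rw [RingHom.id_apply, ← MemLp.toLp_const_smul]
    refine MemLp.toLp_congr _ _ ?_
    filter_upwards [Lp.coeFn_smul c (f : L2)] with x hx
    simp only [Submodule.coe_smul, Pi.smul_apply]
    rw [hx, Pi.smul_apply, smul_eq_mul, smul_eq_mul, mul_div_assoc]

/-- Poincaré's inequality on `W_0^{1,2}(0, 1)`. -/
lemma poincare {p : L2 × L2} (hp : p ∈ testPairs.topologicalClosure) : ‖p.1‖ ≤ 2 * ‖p.2‖ := by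
  have h1 : eLpNorm p.1 2 muI ≤ eLpNorm (fun x => p.1 x / (x : ℂ)) 2 muI := by
    refine eLpNorm_mono_ae ?_
    filter_upwards [ae_restrict_mem measurableSet_Ioo] with x hx
    rw [norm_div, Complex.norm_real, Real.norm_of_nonneg hx.1.le]
    exact le_div_self (norm_nonneg _) hx.1 hx.2.le
  have h2 := h1.trans (hardy_closure hp)
  rw [Lp.norm_def, Lp.norm_def]
  have := ENNReal.toReal_mono (ENNReal.mul_ne_top (by simp) (Lp.memLp p.2).2.ne) h2
  simpa using this

/-! ## The Hilbert space `ℋ = W_0^{1,2} × L²` -/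

/-- `W_0^{1,2}(0, 1)`, as a type of its own: it carries the inner product `⟨f', g'⟩`, not the one
inherited from `L²`. -/
def H10 : Type := W012

instance : AddCommGroup H10 := inferInstanceAs (AddCommGroup W012)
instance : Module ℂ H10 := inferInstanceAs (Module ℂ W012)

/-- The tautological identification of `H10` with the subspace `W012` of `L²`. -/
def H10.equiv : H10 ≃ₗ[ℂ] W012 := LinearEquiv.refl ℂ W012

/-- The derivative `H10 → L²`. -/
def H10.D : H10 →ₗ[ℂ] L2 := weakDeriv₀ ∘ₗ H10.equiv.toLinearMap

lemma H10.poincare (u : H10) : ‖(H10.equiv u : L2)‖ ≤ 2 * ‖H10.D u‖ :=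
  DampedWave.poincare (p := ((H10.equiv u : L2), weakDeriv₀ (H10.equiv u)))
    (mem_closure_of_W012 (H10.equiv u))

/-- The inner product `⟨u', v'⟩` on `W_0^{1,2}(0, 1)`. -/
@[reducible]
def H10.core : InnerProductSpace.Core ℂ H10 where
  inner u v := ⟪H10.D u, H10.D v⟫_ℂ
  conj_inner_symm u v := inner_conj_symm _ _
  re_inner_nonneg u := inner_self_nonneg
  add_left u v w := by rw [map_add, inner_add_left]
  smul_left u v c := by rw [map_smul, inner_smul_left]
  definite u hu := by
    have h0 : H10.D u = 0 := inner_self_eq_zero.1 hu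
    have h1 := H10.poincare u
    rw [h0, norm_zero, mul_zero, norm_le_zero_iff] at h1
    exact H10.equiv.map_eq_zero_iff.1 (Subtype.ext h1)

instance : NormedAddCommGroup H10 := H10.core.toNormedAddCommGroup
instance : InnerProductSpace ℂ H10 := InnerProductSpace.ofCore H10.core.toCore

lemma H10.inner_def (u v : H10) : ⟪u, v⟫_ℂ = ⟪H10.D u, H10.D v⟫_ℂ := rfl

lemma H10.norm_def (u : H10) : ‖u‖ = ‖H10.D u‖ := by
  rw [norm_eq_sqrt_re_inner (𝕜 := ℂ) u, H10.inner_def, ← norm_eq_sqrt_re_inner (𝕜 := ℂ)]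

instance : CompleteSpace H10 := by
  refine Metric.complete_of_cauchySeq_tendsto fun u hu => ?_
  have c2 : CauchySeq fun n => H10.D (u n) := by
    rw [Metric.cauchySeq_iff] at hu ⊢
    intro ε hε
    obtain ⟨N, hN⟩ := hu ε hε
    refine ⟨N, fun m hm n hn => ?_⟩
    have := hN m hm n hn
    rwa [dist_eq_norm, H10.norm_def, map_sub, ← dist_eq_norm] at this
  have c1 : CauchySeq fun n => (H10.equiv (u n) : L2) := by
    rw [Metric.cauchySeq_iff] at hu ⊢
    intro ε hε
    obtain ⟨N, hN⟩ := hu (ε / 2) (half_pos hε)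
    refine ⟨N, fun m hm n hn => ?_⟩
    have h1 := hN m hm n hn
    have h2 := H10.poincare (u m - u n)
    rw [dist_eq_norm, H10.norm_def] at h1
    rw [map_sub, Submodule.coe_sub] at h2
    rw [dist_eq_norm]
    linarith
  obtain ⟨f, hf⟩ := cauchySeq_tendsto_of_complete c1
  obtain ⟨g, hg⟩ := cauchySeq_tendsto_of_complete c2
  have hp : (f, g) ∈ testPairs.topologicalClosure :=
    testPairs.isClosed_topologicalClosure.mem_of_tendsto (hf.prodMk_nhds hg)
      (Eventually.of_forall fun n => mem_closure_of_W012 (H10.equiv (u n)))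
  have hw := hasWeakDeriv_of_mem_closure hp
  have hmem : f ∈ W012 := mem_W012_iff.2 ⟨g, hw, hp⟩
  refine ⟨H10.equiv.symm ⟨f, hmem⟩, ?_⟩
  have hD : H10.D (H10.equiv.symm ⟨f, hmem⟩) = g :=
    (hasWeakDeriv_weakDeriv₀ ⟨f, hmem⟩).unique hw
  rw [tendsto_iff_norm_sub_tendsto_zero]
  simp_rw [H10.norm_def, map_sub, hD]
  exact tendsto_iff_norm_sub_tendsto_zero.1 hg

/-- The Hilbert space `ℋ = W_0^{1,2}(0, 1) × L²(0, 1)` with inner product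
`⟨φ₁', ψ₁'⟩ + ⟨φ₂, ψ₂⟩`. -/
abbrev Hsp : Type := WithLp 2 (H10 × L2)

/-! ## The operators -/

/-- `W_0^{1,2}(0, 1) ∩ W^{2,2}(0, 1)`. -/
abbrev domD : Submodule ℂ L2 := W012 ⊓ W22

/-- `Dom(G₀) = (W_0^{1,2} ∩ W^{2,2})²`, as a subspace of `ℋ`. -/
def domG₀ : Submodule ℂ Hsp where
  carrier := {w | (H10.equiv w.fst : L2) ∈ domD ∧ w.snd ∈ domD}
  zero_mem' := by simp
  add_mem' := by
    rintro w w' ⟨h1, h2⟩ ⟨h3, h4⟩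
    exact ⟨domD.add_mem h1 h3, domD.add_mem h2 h4⟩
  smul_mem' := by
    rintro c w ⟨h1, h2⟩
    exact ⟨domD.smul_mem c h1, domD.smul_mem c h2⟩

/-- The initial operator `G₀ (u, v) = (v, u'' - (2 α / x) v)`. -/
def G₀ (α : ℝ) : Hsp →ₗ.[ℂ] Hsp where
  domain := domG₀
  toFun :=
    { toFun := fun w => WithLp.toLp 2
        (H10.equiv.symm ⟨w.1.snd, w.2.2.1⟩,
          weakDeriv₂ ⟨H10.equiv w.1.fst, w.2.1.2⟩ - (2 * α : ℂ) • divX ⟨w.1.snd, w.2.2.1⟩)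
      map_add' := fun w w' => by
        have e1 : (⟨(w + w').1.snd, (w + w').2.2.1⟩ : W012)
          = ⟨w.1.snd, w.2.2.1⟩ + ⟨w'.1.snd, w'.2.2.1⟩ := rfl
        have e2 : (⟨H10.equiv (w + w').1.fst, (w + w').2.1.2⟩ : W22)
          = ⟨H10.equiv w.1.fst, w.2.1.2⟩ + ⟨H10.equiv w'.1.fst, w'.2.1.2⟩ := rfl
        rw [e1, e2, map_add, map_add, map_add, ← WithLp.toLp_add, Prod.mk_add_mk]
        congr 2
        rw [smul_add]
        abel
      map_smul' := fun c w => by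
        have e1 : (⟨(c • w).1.snd, (c • w).2.2.1⟩ : W012) = c • ⟨w.1.snd, w.2.2.1⟩ := rfl
        have e2 : (⟨H10.equiv (c • w).1.fst, (c • w).2.1.2⟩ : W22)
          = c • ⟨H10.equiv w.1.fst, w.2.1.2⟩ := rfl
        rw [e1, e2, map_smul, map_smul, map_smul, RingHom.id_apply, ← WithLp.toLp_smul,
          Prod.smul_mk]
        congr 2
        rw [smul_sub, smul_comm] }

/-- `G`, the closure of `G₀` in `ℋ`. -/
def G (α : ℝ) : Hsp →ₗ.[ℂ] Hsp := (G₀ α).closure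

/-- The operator `T(z) = -d²/dx² + 2 z α / x + z²` in `L²(0, 1)`, with domain
`W_0^{1,2} ∩ W^{2,2}`. -/
def T (α : ℝ) (z : ℂ) : L2 →ₗ.[ℂ] L2 where
  domain := domD
  toFun := - (weakDeriv₂ ∘ₗ Submodule.inclusion inf_le_right)
    + (2 * z * α) • (divX ∘ₗ Submodule.inclusion inf_le_left) + z ^ 2 • domD.subtype

/-! ## Spectrum of an unbounded operator, and generators of contraction semigroups -/

section Abstract

variable {E : Type*} [NormedAddCommGroup E] [NormedSpace ℂ E]

/-- `R` is a bounded, everywhere defined inverse of `z - A`. -/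
def IsResolventAt (A : E →ₗ.[ℂ] E) (z : ℂ) (R : E →L[ℂ] E) : Prop :=
  (∀ y : E, ∃ h : R y ∈ A.domain, z • R y - A ⟨R y, h⟩ = y) ∧
    ∀ x : A.domain, R (z • (x : E) - A x) = x

/-- The resolvent set of `A`. -/
def resolventSet (A : E →ₗ.[ℂ] E) : Set ℂ := {z | ∃ R : E →L[ℂ] E, IsResolventAt A z R}

/-- The spectrum of `A`. -/
def opSpectrum (A : E →ₗ.[ℂ] E) : Set ℂ := (resolventSet A)ᶜ

open scoped Classical in
/-- The resolvent `(z - A)⁻¹` for `z` in the resolvent set (and `0` elsewhere). -/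
def opResolvent (A : E →ₗ.[ℂ] E) (z : ℂ) : E →L[ℂ] E :=
  if h : ∃ R : E →L[ℂ] E, IsResolventAt A z R then h.choose else 0

/-- `z` is an eigenvalue of `A`. -/
def IsEigenvalue (A : E →ₗ.[ℂ] E) (z : ℂ) : Prop :=
  ∃ x : A.domain, (x : E) ≠ 0 ∧ A x = z • (x : E)

/-- The Riesz projection `(2πi)⁻¹ ∮_{|z - c| = r} (z - A)⁻¹ dz`. -/
def rieszProjection (A : E →ₗ.[ℂ] E) (c : ℂ) (r : ℝ) : E →L[ℂ] E :=
  (2 * Real.pi * Complex.I : ℂ)⁻¹ • ∮ z in C(c, r), opResolvent A z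

/-- `c` is an isolated point of the spectrum of `A`, it is an eigenvalue of `A`, and its algebraic
multiplicity (the rank of the Riesz projection on a circle that separates `c` from the rest of the
spectrum) is finite. -/
def IsDiscreteEigenvalue (A : E →ₗ.[ℂ] E) (c : ℂ) : Prop :=
  IsEigenvalue A c ∧ ∃ r : ℝ, 0 < r ∧ Metric.closedBall c r ∩ opSpectrum A = {c} ∧
    FiniteDimensional ℂ (LinearMap.range (rieszProjection A c r).toLinearMap)

/-- `S` is a strongly continuous semigroup of contractions on `E`. -/
structure IsContractionSemigroup (S : ℝ≥0 → E →L[ℂ] E) : Prop where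
  map_zero : S 0 = ContinuousLinearMap.id ℂ E
  map_add : ∀ s t, S (s + t) = (S s).comp (S t)
  continuous : ∀ x, Continuous fun t => S t x
  norm_le_one : ∀ t, ‖S t‖ ≤ 1

/-- `A` is the infinitesimal generator of `S`: `x ∈ Dom(A)` with `A x = y` if and only if
`(S t x - x) / t → y` as `t ↓ 0`. -/
def IsGenerator (A : E →ₗ.[ℂ] E) (S : ℝ≥0 → E →L[ℂ] E) : Prop :=
  ∀ x y : E, (∃ h : x ∈ A.domain, A ⟨x, h⟩ = y) ↔
    Tendsto (fun t : ℝ≥0 => ((t : ℝ) : ℂ)⁻¹ • (S t x - x)) (𝓝[>] 0) (𝓝 y)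

end Abstract

end DampedWave

end

noncomputable section

namespace DampedWave

/-! ## The Hille–Yosida theorem for contraction semigroups -/

section Exp

variable {𝔸 : Type*} [NormedRing 𝔸] [NormedAlgebra ℝ 𝔸]

/-! Everything follows from an explicit compact inverse of `G`. Solving `G (u, v) = (p, q)` gives `v
= p` and `u'' = q + 2αp/x`, and the right side lies in `L²` by Hardy's inequality. In the inner
product `⟨u', v'⟩`, the adjoint `J†` of the embedding `J : W_0^{1,2} → L²` is the solution operator
of `-u'' = g`, so the solution is `u = -J†(q + 2αp/x)`. The resulting operator `invG` is bounded,
injective, and compact by the theorems of Rellich and Schauder. The closure of the graph of `G₀` is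
exactly the flipped graph of `invG` (`mem_closure_graph_iff`), hence `G₀` is closable and `invG`
inverts `G`.

(i) `Re ⟨w, G w⟩ = -2α ∫ |v|²/x ≤ 0` for `w = (u, v)`, so `z - G` is injective for `z > 0`. The
Fredholm alternative then gives resolvents with the Hille–Yosida bounds.

(ii) Both spectral conditions amount to failure of injectivity of a compact perturbation of the
identity: `1 - z • invG` for `G`, and `T(z) J J†` for `T(z)`. Eliminating `v = z u` identifies the
two kernels (`injective_iff`).

(iii) Near a spectral point `c`, adding the finite-rank projection `P` onto the generalized kernel
of `1 - c • invG` makes `1 - z • invG` invertible. The resolvent is therefore analytic at `c` on the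
range of `1 - P`, and the Riesz projection factors through `P`. -/

lemma norm_exp_le_exp_norm [CompleteSpace 𝔸] (h1 : ‖(1 : 𝔸)‖ ≤ 1) (x : 𝔸) :
    ‖NormedSpace.exp x‖ ≤ Real.exp ‖x‖ := by
  have hs := NormedSpace.exp_series_hasSum_exp' (𝕂 := ℝ) x
  have hr : HasSum (fun n : ℕ => ((n.factorial : ℝ))⁻¹ * ‖x‖ ^ n) (Real.exp ‖x‖) := by
    rw [Real.exp_eq_exp_ℝ]
    simpa using NormedSpace.exp_series_hasSum_exp' (𝕂 := ℝ) ‖x‖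
  rw [← hs.tsum_eq]
  refine tsum_of_norm_bounded hr fun n => ?_
  rw [norm_smul, norm_inv, Real.norm_natCast]
  refine mul_le_mul_of_nonneg_left ?_ (by positivity)
  -- Only the term `n = 0` uses `‖1‖ ≤ 1`. Equality is not assumed because the norm of `1` is `0` on
  -- the zero space.
  rcases n.eq_zero_or_pos with rfl | hn
  · simpa using h1
  · exact norm_pow_le' x hn

/-- If `‖b‖ ≤ 1`, then `c (b - 1)` generates a semigroup of contractions. -/
lemma norm_exp_smul_sub_one_le [CompleteSpace 𝔸] (h1 : ‖(1 : 𝔸)‖ ≤ 1) {b : 𝔸} (hb : ‖b‖ ≤ 1) {c : ℝ}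
    (hc : 0 ≤ c) : ‖NormedSpace.exp (c • (b - 1))‖ ≤ 1 := by
  let _ : NormedAlgebra ℚ 𝔸 := NormedAlgebra.restrictScalars ℚ ℝ 𝔸
  have e : c • (b - 1) = c • b + algebraMap ℝ 𝔸 (-c) := by
    rw [Algebra.algebraMap_eq_smul_one, smul_sub, neg_smul, sub_eq_add_neg]
  rw [e, NormedSpace.exp_add_of_commute (Algebra.commutes _ _).symm,
    ← NormedSpace.algebraMap_exp_comm, ← Real.exp_eq_exp_ℝ]
  calc _ ≤ Real.exp (c * 1) * (Real.exp (-c) * 1) := by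
        refine (norm_mul_le _ _).trans (mul_le_mul ?_ ?_ (norm_nonneg _) (by positivity))
        · refine (norm_exp_le_exp_norm h1 _).trans (Real.exp_le_exp.2 ?_)
          rw [norm_smul, Real.norm_of_nonneg hc]
          exact mul_le_mul_of_nonneg_left hb hc
        · rw [Algebra.algebraMap_eq_smul_one, norm_smul, Real.norm_of_nonneg (Real.exp_pos _).le]
          exact mul_le_mul_of_nonneg_left h1 (Real.exp_pos _).le
    _ = 1 := by rw [mul_one, mul_one, ← Real.exp_add]; simp

lemma exp_add_smul [CompleteSpace 𝔸] (a : 𝔸) (s t : ℝ) :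
    NormedSpace.exp ((s + t) • a) = NormedSpace.exp (s • a) * NormedSpace.exp (t • a) := by
  let _ : NormedAlgebra ℚ 𝔸 := NormedAlgebra.restrictScalars ℚ ℝ 𝔸
  rw [add_smul, NormedSpace.exp_add_of_commute]
  exact ((Commute.refl a).smul_left s).smul_right t

lemma commute_exp_smul {a b : 𝔸} (h : Commute a b) (t : ℝ) :
    Commute a (NormedSpace.exp (t • b)) := by
  let _ : NormedAlgebra ℚ 𝔸 := NormedAlgebra.restrictScalars ℚ ℝ 𝔸
  exact (h.smul_right t).exp_right

end Exp

variable {E : Type*} [NormedAddCommGroup E] [NormedSpace ℂ E]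

local notation "exp" => NormedSpace.exp

lemma hasDerivAt_exp_smul_apply [CompleteSpace E] (a : E →L[ℂ] E) (x : E) (t : ℝ) :
    HasDerivAt (fun s : ℝ => exp (s • a) x) (exp (t • a) (a x)) t :=
  (ContinuousLinearMap.apply ℝ E x : (E →L[ℝ] E) →L[ℝ] E).hasFDerivAt.comp_hasDerivAt t
    ((ContinuousLinearMap.restrictScalarsL ℂ E E ℝ ℝ).hasFDerivAt.comp_hasDerivAt t
      (hasDerivAt_exp_smul_const (𝕂 := ℝ) a t))

/-- The path `s ↦ exp(sa) exp((t-s)b) x` joins `exp(tb) x` to `exp(ta) x`. Since `a` and `b`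
commute, its derivative is a contraction applied to `a x - b x`. Only the values at `x` enter, so
strong convergence of generators will suffice. -/
lemma norm_exp_sub_exp_le [CompleteSpace E] {a b : E →L[ℂ] E} (hab : Commute a b)
    (ha : ∀ t : ℝ, 0 ≤ t → ‖exp (t • a)‖ ≤ 1) (hb : ∀ t : ℝ, 0 ≤ t → ‖exp (t • b)‖ ≤ 1)
    (x : E) {t : ℝ} (ht : 0 ≤ t) :
    ‖exp (t • a) x - exp (t • b) x‖ ≤ t * ‖a x - b x‖ := by
  have hd : ∀ s : ℝ, HasDerivAt (fun s : ℝ => (exp (s • a) * exp ((t - s) • b)) x)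
      ((exp (s • a) * exp ((t - s) • b)) (a x - b x)) s := by
    intro s
    have h1 := hasDerivAt_exp_smul_const (𝕂 := ℝ) a s
    have h2 : HasDerivAt (fun s : ℝ => exp ((t - s) • b)) (-(exp ((t - s) • b) * b)) s := by
      refine ((hasDerivAt_exp_smul_const (𝕂 := ℝ) b (t - s)).scomp s
        ((hasDerivAt_id s).const_sub t)).congr_deriv ?_
      exact neg_one_smul ℝ _
    have h3 := (ContinuousLinearMap.apply ℝ E x : (E →L[ℝ] E) →L[ℝ] E).hasFDerivAt.comp_hasDerivAt
      s ((ContinuousLinearMap.restrictScalarsL ℂ E E ℝ ℝ).hasFDerivAt.comp_hasDerivAt s (h1.mul h2))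
    refine h3.congr_deriv ?_
    have hc : a * exp ((t - s) • b) = exp ((t - s) • b) * a := commute_exp_smul hab _
    change (exp (s • a) * a * exp ((t - s) • b) + exp (s • a) * -(exp ((t - s) • b) * b)) x = _
    rw [mul_assoc, hc, map_sub]
    simp [sub_eq_add_neg]
  have := norm_image_sub_le_of_norm_deriv_le_segment' (a := 0) (b := t) (C := ‖a x - b x‖)
    (fun s _ => (hd s).hasDerivWithinAt) (fun s hs => ?_) t ⟨ht, le_rfl⟩
  · simpa [mul_comm] using this
  · have h1 := ha s hs.1
    have h2 := hb (t - s) (by linarith [hs.2])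
    refine (ContinuousLinearMap.le_opNorm _ _).trans (mul_le_of_le_one_left (norm_nonneg _) ?_)
    exact (norm_mul_le _ _).trans (mul_le_one₀ h1 (norm_nonneg _) h2)

lemma norm_exp_sub_self_le [CompleteSpace E] {a : E →L[ℂ] E}
    (ha : ∀ t : ℝ, 0 ≤ t → ‖exp (t • a)‖ ≤ 1) (x : E) {t : ℝ} (ht : 0 ≤ t) :
    ‖exp (t • a) x - x‖ ≤ t * ‖a x‖ := by
  have h := norm_exp_sub_exp_le (Commute.zero_right a) ha
    (fun t _ => by
      rw [smul_zero, NormedSpace.exp_zero]; exact ContinuousLinearMap.norm_id_le) x ht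
  simpa using h

/-- Mean value inequality for `exp(sa) x - s a x`. This first-order estimate survives the passage to
the limit and identifies the generator. -/
lemma norm_exp_sub_self_sub_le [CompleteSpace E] {a : E →L[ℂ] E} (x : E) {t c : ℝ} (ht : 0 ≤ t)
    (hc : ∀ s ∈ Icc 0 t, ‖exp (s • a) (a x) - a x‖ ≤ c) :
    ‖exp (t • a) x - x - t • a x‖ ≤ c * t := by
  have hd : ∀ s : ℝ, HasDerivAt (fun s : ℝ => exp (s • a) x - s • a x)
      (exp (s • a) (a x) - a x) s := fun s =>
    ((hasDerivAt_exp_smul_apply a x s).sub ((hasDerivAt_id s).smul_const (a x))).congr_deriv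
      (by rw [one_smul])
  have := norm_image_sub_le_of_norm_deriv_le_segment' (a := 0) (b := t) (C := c)
    (fun s _ => (hd s).hasDerivWithinAt) (fun s hs => hc s ⟨hs.1, hs.2.le⟩) t ⟨ht, le_rfl⟩
  simp only [zero_smul, NormedSpace.exp_zero, sub_zero] at this
  rwa [one_apply_eq_self, sub_right_comm] at this


/-! ### Resolvent identity and Yosida approximation. -/

lemma IsResolventAt.sub_eq {A : E →ₗ.[ℂ] E} {z w : ℂ} {R S : E →L[ℂ] E}
    (hR : IsResolventAt A z R) (hS : IsResolventAt A w S) : R - S = (w - z) • (R * S) := by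
  ext y
  obtain ⟨h, hy⟩ := hS.1 y
  have h1 := hR.2 ⟨S y, h⟩
  have h2 : R y = R ((w - z) • S y + (z • S y - A ⟨S y, h⟩)) := by
    conv_lhs => rw [← hy]
    congr 1; module
  rw [map_add, h1, map_smul] at h2
  change R y - S y = (w - z) • R (S y)
  rw [h2]; abel

lemma IsResolventAt.commute {A : E →ₗ.[ℂ] E} {z w : ℂ} {R S : E →L[ℂ] E}
    (hR : IsResolventAt A z R) (hS : IsResolventAt A w S) : Commute R S := by
  have h1 := hR.sub_eq hS
  have h2 := hS.sub_eq hR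
  by_cases hzw : w = z
  · rw [hzw, sub_self, zero_smul, sub_eq_zero] at h1
    rw [h1]
  · refine smul_right_injective _ (sub_ne_zero.2 hzw) ?_
    change (w - z) • (R * S) = (w - z) • (S * R)
    rw [← h1, ← neg_sub S R, h2, ← neg_smul, neg_sub]

/-- The Yosida approximation `λ (λ R - 1)` with `λ = n + 1`. -/
def yosida (R : ℕ → E →L[ℂ] E) (n : ℕ) : E →L[ℂ] E :=
  ((n : ℝ) + 1) • (((n : ℂ) + 1) • R n - 1)

section Yosida

variable {A : E →ₗ.[ℂ] E} {R : ℕ → E →L[ℂ] E}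

lemma norm_smul_resolvent_le (hb : ∀ n, ‖R n‖ ≤ ((n : ℝ) + 1)⁻¹) (n : ℕ) :
    ‖((n : ℂ) + 1) • R n‖ ≤ 1 := by
  have h : ‖(n : ℂ) + 1‖ = (n : ℝ) + 1 := by
    rw [show (n : ℂ) + 1 = ((n + 1 : ℕ) : ℂ) by push_cast; rfl, Complex.norm_natCast]
    push_cast; rfl
  have h' : (0 : ℝ) < (n : ℝ) + 1 := by positivity
  rw [norm_smul, h]
  calc _ ≤ ((n : ℝ) + 1) * ((n : ℝ) + 1)⁻¹ := mul_le_mul_of_nonneg_left (hb n) h'.le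
    _ = 1 := mul_inv_cancel₀ h'.ne'

lemma norm_exp_yosida_le [CompleteSpace E] (hb : ∀ n, ‖R n‖ ≤ ((n : ℝ) + 1)⁻¹) (n : ℕ)
    {t : ℝ} (ht : 0 ≤ t) :
    ‖exp (t • yosida R n)‖ ≤ 1 := by
  rw [yosida, smul_smul]
  exact norm_exp_smul_sub_one_le ContinuousLinearMap.norm_id_le
    (norm_smul_resolvent_le hb n) (by positivity)

lemma commute_yosida (hR : ∀ n : ℕ, IsResolventAt A ((n : ℂ) + 1) (R n)) (m n : ℕ) :
    Commute (yosida R m) (yosida R n) := by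
  have h := (hR m).commute (hR n)
  refine Commute.smul_left (Commute.smul_right ?_ _) _
  refine Commute.sub_left (Commute.sub_right ?_ (Commute.one_right _)) (Commute.one_left _)
  exact (h.smul_left _).smul_right _

/-- On the domain `λ R x - x = R A x`, so the approximant is `A` followed by the contraction `λ R`.
-/
lemma yosida_apply (hR : ∀ n : ℕ, IsResolventAt A ((n : ℂ) + 1) (R n)) (n : ℕ) (x : A.domain) :
    yosida R n x = (((n : ℂ) + 1) • R n) (A x) := by
  have h := (hR n).2 x
  rw [map_sub, map_smul, sub_eq_iff_eq_add, ← sub_eq_iff_eq_add'] at h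
  change ((n : ℝ) + 1) • (((n : ℂ) + 1) • R n x - x) = ((n : ℂ) + 1) • R n (A x)
  rw [h, ← Complex.coe_smul]
  push_cast; rfl

/-- On the domain the error is `R A x`, of order `1/λ`. Density and the contractivity of `λ R` give
the rest: the two terms with `y - x` cost `ε/4` each and `R A x` costs `ε/2`. -/
lemma tendsto_smul_resolvent (hR : ∀ n : ℕ, IsResolventAt A ((n : ℂ) + 1) (R n))
    (hb : ∀ n, ‖R n‖ ≤ ((n : ℝ) + 1)⁻¹) (hd : Dense (A.domain : Set E)) (y : E) :
    Tendsto (fun n : ℕ => (((n : ℂ) + 1) • R n) y) atTop (𝓝 y) := by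
  rw [Metric.tendsto_atTop]
  intro ε hε
  obtain ⟨x, hx, hxy⟩ := Metric.mem_closure_iff.1 (hd y) (ε / 4) (by positivity)
  have h0 : Tendsto (fun n : ℕ => ((n : ℝ) + 1)⁻¹ * ‖A ⟨x, hx⟩‖) atTop (𝓝 0) := by
    simpa using (tendsto_one_div_add_atTop_nhds_zero_nat (𝕜 := ℝ)).mul_const ‖A ⟨x, hx⟩‖
  obtain ⟨N, hN⟩ := (h0.eventually_lt_const (show 0 < ε / 2 by positivity)).exists_forall_of_atTop
  refine ⟨N, fun n hn => ?_⟩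
  have h1 : (((n : ℂ) + 1) • R n) x - x = R n (A ⟨x, hx⟩) := by
    have h := (hR n).2 ⟨x, hx⟩
    rw [map_sub, map_smul, sub_eq_iff_eq_add, ← sub_eq_iff_eq_add'] at h
    exact h
  have h2 : (((n : ℂ) + 1) • R n) y - y
      = (((n : ℂ) + 1) • R n) (y - x) - (y - x) + R n (A ⟨x, hx⟩) := by
    rw [← h1, map_sub]; abel
  have h3 := ContinuousLinearMap.le_of_opNorm_le _ (norm_smul_resolvent_le hb n) (y - x)
  have h4 := ContinuousLinearMap.le_of_opNorm_le _ (hb n) (A ⟨x, hx⟩)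
  rw [dist_eq_norm] at hxy ⊢
  rw [h2]
  have h5 := norm_add_le ((((n : ℂ) + 1) • R n) (y - x) - (y - x)) (R n (A ⟨x, hx⟩))
  have h6 := norm_sub_le ((((n : ℂ) + 1) • R n) (y - x)) (y - x)
  have := hN n hn
  linarith

lemma tendsto_yosida (hR : ∀ n : ℕ, IsResolventAt A ((n : ℂ) + 1) (R n))
    (hb : ∀ n, ‖R n‖ ≤ ((n : ℝ) + 1)⁻¹) (hd : Dense (A.domain : Set E)) (x : A.domain) :
    Tendsto (fun n : ℕ => yosida R n x) atTop (𝓝 (A x)) := by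
  simp_rw [yosida_apply hR]
  exact tendsto_smul_resolvent hR hb hd _

lemma exists_tendsto_exp_yosida [CompleteSpace E]
    (hR : ∀ n : ℕ, IsResolventAt A ((n : ℂ) + 1) (R n))
    (hb : ∀ n, ‖R n‖ ≤ ((n : ℝ) + 1)⁻¹) (hd : Dense (A.domain : Set E)) {t : ℝ} (ht : 0 ≤ t)
    (y : E) : ∃ l, Tendsto (fun n : ℕ => exp (t • yosida R n) y) atTop (𝓝 l) := by
  refine cauchySeq_tendsto_of_complete (Metric.cauchySeq_iff.2 fun ε hε => ?_)
  obtain ⟨x, hx, hxy⟩ := Metric.mem_closure_iff.1 (hd y) (ε / 4) (by positivity)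
  have hc := (tendsto_yosida hR hb hd ⟨x, hx⟩).cauchySeq
  -- Dividing by `t + 1` rather than `t` allows `t = 0`.
  obtain ⟨N, hN⟩ := Metric.cauchySeq_iff.1 hc (ε / (2 * (t + 1))) (by positivity)
  refine ⟨N, fun m hm n hn => ?_⟩
  have h1 := norm_exp_sub_exp_le (commute_yosida hR m n) (fun s => norm_exp_yosida_le hb m)
    (fun s => norm_exp_yosida_le hb n) x ht
  have h2 := hN m hm n hn
  have h3 := ContinuousLinearMap.le_of_opNorm_le _ (norm_exp_yosida_le hb m ht) (y - x)
  have h4 := ContinuousLinearMap.le_of_opNorm_le _ (norm_exp_yosida_le hb n ht) (y - x)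
  rw [dist_eq_norm] at hxy h2 ⊢
  have h5 : t * ‖yosida R m x - yosida R n x‖ ≤ ε / 2 := by
    calc _ ≤ (t + 1) * (ε / (2 * (t + 1))) :=
          mul_le_mul (by linarith) h2.le (norm_nonneg _) (by positivity)
      _ = ε / 2 := by field_simp
  have e : exp (t • yosida R m) y - exp (t • yosida R n) y
      = (exp (t • yosida R m) x - exp (t • yosida R n) x)
        + (exp (t • yosida R m) (y - x) - exp (t • yosida R n) (y - x)) := by
    rw [map_sub, map_sub]; abel
  rw [e]
  have h6 := norm_add_le (exp (t • yosida R m) x - exp (t • yosida R n) x)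
    (exp (t • yosida R m) (y - x) - exp (t • yosida R n) (y - x))
  have h7 := norm_sub_le (exp (t • yosida R m) (y - x)) (exp (t • yosida R n) (y - x))
  linarith

end Yosida

/-- The generator of a contraction semigroup does not have the eigenvalue `1`. -/
lemma eq_zero_of_tendsto_self {S : ℝ≥0 → E →L[ℂ] E} (hS : ∀ t, ‖S t‖ ≤ 1) {d : E}
    (h : Tendsto (fun t : ℝ≥0 => ((t : ℝ) : ℂ)⁻¹ • (S t d - d)) (𝓝[>] 0) (𝓝 d)) : d = 0 := by
  have h1 : Tendsto (fun t : ℝ≥0 => ‖((t : ℝ) : ℂ)⁻¹ • (S t d - d) - d‖) (𝓝[>] 0) (𝓝 0) := by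
    simpa using (h.sub_const d).norm
  refine norm_le_zero_iff.1 (ge_of_tendsto h1 ?_)
  filter_upwards [self_mem_nhdsWithin] with t ht
  have ht' : (0 : ℝ) < t := ht
  -- Taking norms, `(1 + t)‖d‖ ≤ ‖d‖ + t ‖error‖`, where the error is the difference quotient minus
  -- `d`; hence `‖d‖ ≤ ‖error‖ → 0`.
  have h2 : d + (((t : ℝ) : ℂ) • d)
      = S t d - ((t : ℝ) : ℂ) • (((t : ℝ) : ℂ)⁻¹ • (S t d - d) - d) := by
    rw [smul_sub, smul_inv_smul₀ (by exact_mod_cast ht'.ne')]; abel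
  have h3 : ‖d + (((t : ℝ) : ℂ) • d)‖ = (1 + t) * ‖d‖ := by
    rw [show d + (((t : ℝ) : ℂ) • d) = ((1 + t : ℝ) : ℂ) • d by push_cast; module, norm_smul,
      Complex.norm_real, Real.norm_of_nonneg (by positivity)]
  have h4 := norm_sub_le (S t d) (((t : ℝ) : ℂ) • (((t : ℝ) : ℂ)⁻¹ • (S t d - d) - d))
  rw [← h2, h3, norm_smul, Complex.norm_real, Real.norm_of_nonneg ht'.le] at h4
  have h5 := ContinuousLinearMap.le_of_opNorm_le _ (hS t) d
  have h6 : (t : ℝ) * ‖d‖ ≤ t * ‖((t : ℝ) : ℂ)⁻¹ • (S t d - d) - d‖ := by linarith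
  exact le_of_mul_le_mul_left h6 ht'

/-- The Hille–Yosida theorem for contraction semigroups. -/
theorem exists_contractionSemigroup [CompleteSpace E] {A : E →ₗ.[ℂ] E} {R : ℕ → E →L[ℂ] E}
    (hR : ∀ n : ℕ, IsResolventAt A ((n : ℂ) + 1) (R n))
    (hb : ∀ n, ‖R n‖ ≤ ((n : ℝ) + 1)⁻¹) (hd : Dense (A.domain : Set E)) :
    ∃ S : ℝ≥0 → E →L[ℂ] E, IsContractionSemigroup S ∧ IsGenerator A S := by
  choose f hf using fun (t : ℝ≥0) (y : E) => exists_tendsto_exp_yosida hR hb hd t.2 y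
  let S : ℝ≥0 → E →L[ℂ] E := fun t =>
    continuousLinearMapOfTendsto (fun n => exp ((t : ℝ) • yosida R n)) (tendsto_pi_nhds.2 (hf t))
  have hS : ∀ (t : ℝ≥0) (y : E), Tendsto (fun n => exp ((t : ℝ) • yosida R n) y) atTop
    (𝓝 (S t y)) := hf
  have hn : ∀ t, ‖S t‖ ≤ 1 := fun t => by
    refine ContinuousLinearMap.opNorm_le_bound _ zero_le_one fun y => ?_
    exact le_of_tendsto (hS t y).norm (Eventually.of_forall fun n =>
      ContinuousLinearMap.le_of_opNorm_le _ (norm_exp_yosida_le hb n t.2) y)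
  have hadd : ∀ s t : ℝ≥0, S (s + t) = (S s).comp (S t) := by
    intro s t
    ext y
    refine tendsto_nhds_unique (hS (s + t) y) ?_
    have h1 := hS s (S t y)
    have h2 : Tendsto (fun n => exp ((s : ℝ) • yosida R n) (exp ((t : ℝ) • yosida R n) y - S t y))
        atTop (𝓝 0) := by
      refine squeeze_zero_norm (a := fun n => 1 * ‖exp ((t : ℝ) • yosida R n) y - S t y‖)
        (fun n => ContinuousLinearMap.le_of_opNorm_le _ (norm_exp_yosida_le hb n s.2) _) ?_
      simpa using ((hS t y).sub_const (S t y)).norm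
    have h3 := h1.add h2
    rw [add_zero] at h3
    refine h3.congr fun n => ?_
    rw [map_sub, add_sub_cancel, NNReal.coe_add]
    exact (DFunLike.congr_fun (exp_add_smul (yosida R n) (s : ℝ) (t : ℝ)) y).symm
  have hzero : S 0 = ContinuousLinearMap.id ℂ E := by
    ext y
    refine tendsto_nhds_unique (hS 0 y) ?_
    simp
  have hlip : ∀ (x : A.domain) (t : ℝ≥0), ‖S t x - x‖ ≤ t * ‖A x‖ := fun x t =>
    le_of_tendsto_of_tendsto ((hS t x).sub_const _).norm
      ((tendsto_yosida hR hb hd x).norm.const_mul _)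
      (Eventually.of_forall fun n => norm_exp_sub_self_le (fun s => norm_exp_yosida_le hb n) x t.2)
  have hlip' : ∀ (x : A.domain) (s t : ℝ≥0), s ≤ t → ‖S t x - S s x‖ ≤ (t - s) * ‖A x‖ := by
    intro x s t hst
    obtain ⟨r, rfl⟩ := exists_add_of_le hst
    have h1 := ContinuousLinearMap.le_of_opNorm_le _ (hn s) (S r x - x)
    rw [hadd, ContinuousLinearMap.comp_apply, ← map_sub]
    have := hlip x r
    push_cast
    rw [add_sub_cancel_left]
    linarith
  have hcont : ∀ y, Continuous fun t => S t y := by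
    intro y
    -- Orbits starting in the domain are Lipschitz, and contractivity makes them approximate every
    -- orbit uniformly in `t`.
    refine continuous_of_uniform_approx_of_continuous fun u hu => ?_
    obtain ⟨ε, hε, hεu⟩ := Metric.mem_uniformity_dist.1 hu
    obtain ⟨x, hx, hxy⟩ := Metric.mem_closure_iff.1 (hd y) ε hε
    refine ⟨fun t => S t x, ?_, fun t => hεu ?_⟩
    · refine (LipschitzWith.of_dist_le_mul (K := ‖A ⟨x, hx⟩‖₊) fun s t => ?_).continuous
      rw [coe_nnnorm, NNReal.dist_eq]
      rcases le_total s t with hst | hst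
      · rw [dist_comm, dist_eq_norm, abs_sub_comm,
          abs_of_nonneg (sub_nonneg.2 (NNReal.coe_le_coe.2 hst)), mul_comm]
        exact hlip' ⟨x, hx⟩ s t hst
      · rw [dist_eq_norm, abs_of_nonneg (sub_nonneg.2 (NNReal.coe_le_coe.2 hst)), mul_comm]
        exact hlip' ⟨x, hx⟩ t s hst
    · rw [dist_eq_norm] at hxy ⊢
      rw [← map_sub]
      have := ContinuousLinearMap.le_of_opNorm_le _ (hn t) (y - x)
      linarith
  have hgen : ∀ x : A.domain,
      Tendsto (fun t : ℝ≥0 => ((t : ℝ) : ℂ)⁻¹ • (S t x - x)) (𝓝[>] 0) (𝓝 (A x)) := by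
    intro x
    -- The vector `A x` need not lie in the domain, so it is approximated by some `y` that does.
    -- Moving `y` costs at most `t ‖A y‖`, and the remainder `A x - y` is counted twice.
    have key : ∀ (y : A.domain) (t : ℝ≥0),
        ‖S t x - x - (t : ℝ) • A x‖ ≤ (2 * ‖A x - y‖ + t * ‖A y‖) * t := by
      intro y t
      have l1 := tendsto_yosida hR hb hd x
      have l2 := tendsto_yosida hR hb hd y
      refine le_of_tendsto_of_tendsto
        (((hS t x).sub_const (x : E)).sub (l1.const_smul (t : ℝ))).norm
        ((((l1.sub_const (y : E)).norm.const_mul 2).add (l2.norm.const_mul (t : ℝ))).mul_const _)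
        (Eventually.of_forall fun n => ?_)
      refine norm_exp_sub_self_sub_le _ t.2 fun s hs => ?_
      have h1 := ContinuousLinearMap.le_of_opNorm_le _ (norm_exp_yosida_le hb n hs.1)
        (yosida R n x - y)
      have h2 := norm_exp_sub_self_le (fun s => norm_exp_yosida_le hb n) (y : E) hs.1
      have h3 : s * ‖yosida R n y‖ ≤ t * ‖yosida R n y‖ :=
        mul_le_mul_of_nonneg_right hs.2 (norm_nonneg _)
      have e : exp (s • yosida R n) (yosida R n x) - yosida R n x
          = (exp (s • yosida R n) (yosida R n x - y) - (yosida R n x - y))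
            + (exp (s • yosida R n) y - y) := by rw [map_sub]; abel
      rw [e]
      have h4 := norm_add_le (exp (s • yosida R n) (yosida R n x - y) - (yosida R n x - y))
        (exp (s • yosida R n) y - y)
      have h5 := norm_sub_le (exp (s • yosida R n) (yosida R n x - y)) (yosida R n x - y)
      linarith
    rw [Metric.tendsto_nhds]
    intro ε hε
    obtain ⟨y, hy, hxy⟩ := Metric.mem_closure_iff.1 (hd (A x)) (ε / 4) (by positivity)
    rw [dist_eq_norm] at hxy
    have l0 : Tendsto (fun t : ℝ≥0 => (t : ℝ) * ‖A ⟨y, hy⟩‖) (𝓝[>] 0) (𝓝 0) := by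
      have : Tendsto (fun t : ℝ≥0 => (t : ℝ) * ‖A ⟨y, hy⟩‖) (𝓝 0)
          (𝓝 (((0 : ℝ≥0) : ℝ) * ‖A ⟨y, hy⟩‖)) :=
        (NNReal.continuous_coe.mul continuous_const).tendsto 0
      rw [NNReal.coe_zero, zero_mul] at this
      exact this.mono_left nhdsWithin_le_nhds
    filter_upwards [self_mem_nhdsWithin, l0.eventually_lt_const (show 0 < ε / 2 by positivity)]
      with t ht ht2
    have ht' : (0 : ℝ) < t := ht
    have h1 := key ⟨y, hy⟩ t
    have e : S t x - x - (t : ℝ) • A x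
        = ((t : ℝ) : ℂ) • (((t : ℝ) : ℂ)⁻¹ • (S t x - x) - A x) := by
      rw [smul_sub, smul_inv_smul₀ (by exact_mod_cast ht'.ne'), Complex.coe_smul]
    rw [e, norm_smul, Complex.norm_real, Real.norm_of_nonneg ht'.le, mul_comm] at h1
    have h2 := le_of_mul_le_mul_right h1 ht'
    rw [dist_eq_norm]
    linarith
  refine ⟨S, ⟨hzero, hadd, hcont, hn⟩, fun x y => ⟨?_, fun h => ?_⟩⟩
  · rintro ⟨hx, rfl⟩
    exact hgen ⟨x, hx⟩
  -- With `x' = (1 - A)⁻¹ (x - y)`, the generator of `S` sends `x - x'` to `y - A x' = x - x'`. It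
  -- has no eigenvalue `1`, so `x = x'` lies in the domain.
  · obtain ⟨hm, he⟩ := (hR 0).1 (x - y)
    have h1 := hgen ⟨R 0 (x - y), hm⟩
    simp only [Nat.cast_zero, zero_add, one_smul] at he
    have h2 : x - R 0 (x - y) = 0 := by
      refine eq_zero_of_tendsto_self hn ?_
      have h3 := h.sub h1
      have e : y - A ⟨R 0 (x - y), hm⟩ = x - R 0 (x - y) := by
        rw [← sub_eq_zero, ← sub_eq_zero.2 he]; abel
      rw [e] at h3
      refine h3.congr fun t => ?_
      rw [← smul_sub, map_sub (S t) x]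
      congr 1; simp only; abel
    rw [sub_eq_zero] at h2
    rw [← h2] at hm
    refine ⟨hm, ?_⟩
    have e : (⟨R 0 (x - y), (hR 0).1 (x - y) |>.1⟩ : A.domain) = ⟨x, hm⟩ := Subtype.ext h2.symm
    rw [e, ← h2, sub_right_inj] at he
    exact he

end DampedWave

namespace DampedWave

/-! ## Riesz theory of compact operators -/

section Fredholm

variable {E : Type*} [NormedAddCommGroup E] [NormedSpace ℂ E]

/-- The Fredholm alternative: `1 - K` is invertible if it is injective. -/
lemma isUnit_one_sub_of_injective [CompleteSpace E] {K : E →L[ℂ] E} (hK : IsCompactOperator K)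
    (h : ∀ x, K x = x → x = 0) : IsUnit (1 - K) := by
  rcases hK.hasEigenvalue_or_mem_resolventSet (one_ne_zero (α := ℂ)) with h1 | h1
  · obtain ⟨x, hx⟩ := h1.exists_hasEigenvector
    exact absurd (h x (by simpa using hx.apply_eq_smul)) hx.2
  · rw [spectrum.mem_resolventSet_iff, map_one] at h1
    exact h1

/-- Powers of `1 - K` remain compact perturbations of the identity, so the Fredholm alternative
applies to them too. -/
lemma exists_pow_eq_one_sub {K : E →L[ℂ] E} (hK : IsCompactOperator K) (n : ℕ) :
    ∃ L : E →L[ℂ] E, IsCompactOperator L ∧ (1 - K) ^ n = 1 - L := by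
  induction n with
  | zero => exact ⟨0, isCompactOperator_zero, by simp⟩
  | succ n ih =>
    obtain ⟨L, hL, h⟩ := ih
    have hLK : IsCompactOperator ((1 - L) * K : E →L[ℂ] E) := by
      rw [FunLike.coe_mul_eq_comp]
      exact hK.clm_comp (1 - L)
    refine ⟨L + (1 - L) * K, hL.add hLK, ?_⟩
    rw [pow_succ, h]
    noncomm_ring

lemma isCompactOperator_of_range_le {F : Type*} [NormedAddCommGroup F] [NormedSpace ℂ F]
    {T : F →L[ℂ] E} {V : Submodule ℂ E} [FiniteDimensional ℂ V] (h : ∀ x, T x ∈ V) :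
    IsCompactOperator T := by
  have := FiniteDimensional.proper ℂ V
  have : IsCompactOperator (V.subtypeL ∘ T.codRestrict V h) :=
    (isCompactOperator_of_locallyCompactSpace_dom (T.codRestrict V h)).clm_comp V.subtypeL
  exact this

lemma isClosed_ker (S : E →L[ℂ] E) : IsClosed (LinearMap.ker S.toLinearMap : Set E) :=
  S.isClosed_ker

lemma finiteDimensional_ker_one_sub {K : E →L[ℂ] E} (hK : IsCompactOperator K) :
    FiniteDimensional ℂ (LinearMap.ker (1 - K : E →L[ℂ] E).toLinearMap) := by
  have hx : ∀ x ∈ LinearMap.ker (1 - K : E →L[ℂ] E).toLinearMap, K x = x := fun x hx =>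
    (sub_eq_zero.1 hx).symm
  refine FiniteDimensional.of_isCompactOperator_id (𝕜 := ℂ) ?_
  have h := IsCompactOperator.restrict (f := K.toLinearMap) hK
    (V := LinearMap.ker (1 - K : E →L[ℂ] E).toLinearMap)
    (fun x h => by change K x ∈ _; rwa [hx x h]) (isClosed_ker _)
  convert! h using 1
  ext x
  exact (hx x x.2).symm

end Fredholm

variable {E : Type*} [NormedAddCommGroup E] [InnerProductSpace ℂ E] [CompleteSpace E]

/-- The kernels of the powers of `1 - K` are eventually constant. -/
lemma exists_ker_pow_eq {K : E →L[ℂ] E} (hK : IsCompactOperator K) :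
    ∃ n : ℕ, ∀ x, ((1 - K) ^ (n + 1)) x = 0 → ((1 - K) ^ n) x = 0 := by
  by_contra! hcon
  set S : E →L[ℂ] E := 1 - K with hS
  have hmono : ∀ {m n : ℕ}, m ≤ n → ∀ x, (S ^ m) x = 0 → (S ^ n) x = 0 := by
    intro m n hmn x hx
    obtain ⟨k, rfl⟩ := Nat.exists_eq_add_of_le' hmn
    rw [pow_add, mul_apply_eq_comp, hx, map_zero]
  -- If the kernels grow strictly, each contains a unit vector orthogonal to the previous one.
  have hseq : ∀ n, ∃ e : E, ‖e‖ = 1 ∧ (S ^ (n + 1)) e = 0 ∧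
      ∀ w, (S ^ n) w = 0 → ⟪e, w⟫_ℂ = 0 := by
    intro n
    obtain ⟨x, hx1, hx2⟩ := hcon n
    let N := LinearMap.ker (S ^ n).toLinearMap
    have : CompleteSpace N := (isClosed_ker (S ^ n)).completeSpace_coe
    have hp : (S ^ n) (N.starProjection x) = 0 := N.starProjection_apply_mem x
    let d := x - N.starProjection x
    have hd0 : d ≠ 0 := by
      intro h
      rw [sub_eq_zero] at h
      exact hx2 (by rw [h, hp])
    refine ⟨((‖d‖⁻¹ : ℝ) : ℂ) • d, ?_, ?_, fun w hw => ?_⟩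
    · rw [norm_smul, Complex.norm_real, norm_inv, norm_norm,
        inv_mul_cancel₀ (norm_ne_zero_iff.2 hd0)]
    · rw [map_smul, map_sub, hx1, hmono n.le_succ _ hp, sub_zero, smul_zero]
    · rw [inner_smul_left, N.starProjection_inner_eq_zero x w hw, mul_zero]
  choose e he1 he2 he3 using hseq
  have hsep : ∀ m n : ℕ, m < n → 1 ≤ ‖K (e n) - K (e m)‖ := by
    intro m n hmn
    have hSS : ∀ k x, (S ^ k) (S x) = (S ^ (k + 1)) x := fun k x => by rw [pow_succ]; rfl
    have hSS' : ∀ k x, S ((S ^ k) x) = (S ^ (k + 1)) x := fun k x => by rw [pow_succ']; rfl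
    have hKx : ∀ x, K x = x - S x := fun x => by simp [hS]
    have hem : (S ^ n) (e m) = 0 := hmono (Nat.succ_le_of_lt hmn) _ (he2 m)
    have hw : (S ^ n) (S (e n) + (e m - S (e m))) = 0 := by
      rw [map_add, map_sub, hSS, hSS, he2, hem, ← hSS', hem]; simp
    -- The bracket lies in the kernel of `S ^ n`, to which `e n` is orthogonal. By Pythagoras the
    -- images are at distance at least `1`, which contradicts compactness.
    have e1 : K (e n) - K (e m) = e n - (S (e n) + (e m - S (e m))) := by
      rw [hKx, hKx]; abel
    have h2 := norm_sub_sq (𝕜 := ℂ) (e n) (S (e n) + (e m - S (e m)))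
    rw [he3 n _ hw, he1, ← e1] at h2
    simp only [map_zero, mul_zero, sub_zero] at h2
    nlinarith [sq_nonneg ‖S (e n) + (e m - S (e m))‖, norm_nonneg (K (e n) - K (e m))]
  obtain ⟨Q, hQ, hQ'⟩ := hK.image_closedBall_subset_compact 1
  obtain ⟨y, -, ψ, hψ, hy⟩ := hQ.tendsto_subseq (x := fun n => K (e n))
    (fun n => hQ' ⟨e n, by simp [he1], rfl⟩)
  obtain ⟨N, hN⟩ := Metric.cauchySeq_iff'.1 hy.cauchySeq 1 one_pos
  have h1 := hN (N + 1) (Nat.le_succ N)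
  rw [dist_eq_norm] at h1
  exact absurd h1 (not_lt.2 (hsep _ _ (hψ (Nat.lt_succ_self N))))

/-- The Riesz decomposition: a projection `P` of finite rank onto the generalized kernel of
`1 - K`, commuting with the commutant of `K`. -/
lemma exists_riesz_projection {K : E →L[ℂ] E} (hK : IsCompactOperator K) :
    ∃ (n : ℕ) (P : E →L[ℂ] E), FiniteDimensional ℂ (LinearMap.range P.toLinearMap) ∧ P * P = P ∧
      (∀ x, ((1 - K) ^ n) (P x) = 0) ∧ (∀ x, (1 - K) x = 0 → P x = x) ∧
      ∀ T, Commute T K → Commute T P := by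
  obtain ⟨n, hn⟩ := exists_ker_pow_eq hK
  obtain ⟨L, hL, hSL⟩ := exists_pow_eq_one_sub hK n
  set S : E →L[ℂ] E := 1 - K with hS
  set B : E →L[ℂ] E := S ^ n with hB
  have hker : ∀ k x, (S ^ (n + k)) x = 0 → B x = 0 := by
    intro k
    induction k with
    | zero => exact fun x hx => hx
    | succ k ih =>
      intro x hx
      refine ih x ?_
      have h1 : (S ^ (n + 1)) ((S ^ k) x) = 0 := by
        rw [← mul_apply_eq_comp, ← pow_add, add_right_comm]; exact hx
      have h2 := hn _ h1
      rw [pow_add]; exact h2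
  have hBB : ∀ x, B (B x) = 0 → B x = 0 := fun x hx => hker n x (by rw [pow_add]; exact hx)
  let N := LinearMap.ker B.toLinearMap
  have hfin : FiniteDimensional ℂ N := by
    have := finiteDimensional_ker_one_sub hL
    rw [← hSL] at this
    exact this
  let Q := N.starProjection
  have hBQ : ∀ x, B (Q x) = 0 := fun x => N.starProjection_apply_mem x
  have hQN : ∀ x, B x = 0 → Q x = x := fun x hx => N.starProjection_eq_self_iff.2 hx
  have hQc : IsCompactOperator Q := isCompactOperator_of_range_le (V := N) hBQ
  -- If `B x = -Q x`, then `B x` is in the kernel of `B`, so `B x = 0` by `hBB`; then `x = Q x = 0`.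
  -- Compactness of `L - Q` upgrades injectivity to invertibility.
  have hu : IsUnit (B + Q) := by
    have e1 : B + Q = 1 - (L - Q) := by rw [hSL]; abel
    rw [e1]
    refine isUnit_one_sub_of_injective (hL.sub hQc) fun x hx => ?_
    have h1 : B x + Q x = 0 := by
      rw [← _root_.add_apply, e1, _root_.sub_apply, hx]
      exact sub_self x
    have h2 : B x = 0 := by
      refine hBB x ?_
      rw [eq_neg_of_add_eq_zero_left h1, map_neg, hBQ, neg_zero]
    rwa [h2, zero_add, hQN x h2] at h1
  obtain ⟨u, hu⟩ := hu
  have hu1 : ∀ x, u⁻¹.1 (B x + Q x) = x := fun x => by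
    rw [← _root_.add_apply, ← hu, ← mul_apply_eq_comp, Units.inv_mul]; rfl
  have hu2 : ∀ x, B (u⁻¹.1 x) + Q (u⁻¹.1 x) = x := fun x => by
    rw [← _root_.add_apply, ← hu, ← mul_apply_eq_comp, Units.mul_inv]; rfl
  -- Since `u` fixes the kernel of `B` and sends `x - Q x` to `B x`, this `P` fixes the kernel and
  -- kills the range of `B`. It is thus the projection along that range.
  let P : E →L[ℂ] E := Q * u⁻¹.1
  have hPa : ∀ x, P x = Q (u⁻¹.1 x) := fun x => rfl
  have hBP : ∀ x, B (P x) = 0 := fun x => hBQ _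
  have hPN : ∀ x, B x = 0 → P x = x := by
    intro x hx
    have h1 := hu1 x
    rw [hx, zero_add, hQN x hx] at h1
    rw [hPa, h1, hQN x hx]
  have hPB : ∀ x, P (B x) = 0 := by
    intro x
    have h1 := hu1 (x - Q x)
    rw [map_sub, map_sub, hBQ, hQN (Q x) (hBQ x), sub_self, add_zero, sub_zero] at h1
    rw [hPa, h1, map_sub, hQN (Q x) (hBQ x), sub_self]
  refine ⟨n, P, ?_, ?_, hBP, fun x hx => hPN x ?_, fun T hT => ?_⟩
  · refine Submodule.finiteDimensional_of_le (S₂ := N) ?_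
    rintro _ ⟨x, rfl⟩
    exact hBP x
  · ext x
    exact hPN _ (hBP x)
  · refine hker 1 x ?_
    rw [pow_succ, mul_apply_eq_comp, hx, map_zero]
  -- Every vector is a sum from the range and the kernel of `B`, and `T` preserves both.
  · have hTB : Commute T B := ((Commute.one_right T).sub_right hT).pow_right n
    have hTB' : ∀ x, B (T x) = T (B x) := fun x => (DFunLike.congr_fun hTB.eq x).symm
    ext x
    change T (P x) = P (T x)
    conv_rhs => rw [← hu2 x, map_add, ← hTB', map_add, hPB, zero_add, ← hPa]
    exact (hPN _ (by rw [hTB', hBP, map_zero])).symm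

/-! ## Operators with a compact inverse -/

section Inverse

variable {F : Type*} [NormedAddCommGroup F] [NormedSpace ℂ F]

/-- `C` is the everywhere defined inverse of `A`. -/
def IsInverse (A : F →ₗ.[ℂ] F) (C : F →L[ℂ] F) : Prop := ∀ x y, (x, y) ∈ A.graph ↔ x = C y

namespace IsInverse

variable {A : F →ₗ.[ℂ] F} {C : F →L[ℂ] F}

lemma exists_mem (h : IsInverse A C) (y : F) : ∃ hy : C y ∈ A.domain, A ⟨C y, hy⟩ = y := by
  obtain ⟨x, hx, hy⟩ := (LinearPMap.mem_graph_iff A).1 ((h (C y) y).2 rfl)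
  simp only at hx hy
  have hm : C y ∈ A.domain := hx ▸ x.2
  have e : (⟨C y, hm⟩ : A.domain) = x := Subtype.ext hx.symm
  exact ⟨hm, by rw [e, hy]⟩

lemma apply_self (h : IsInverse A C) (x : A.domain) : C (A x) = x :=
  ((h _ _).1 (A.mem_graph x)).symm

lemma injective (h : IsInverse A C) {y : F} (hy : C y = 0) : y = 0 := by
  obtain ⟨h1, h2⟩ := h.exists_mem y
  rw [← h2, ← A.map_zero]
  congr 1
  exact Subtype.ext hy

/-- On the domain `z - A = -(1 - z C) A`, and `C` inverts `A`. Invertibility matters because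
`Ring.inverse` is `0` off the units. -/
lemma isResolventAt (h : IsInverse A C) {z : ℂ} (hz : IsUnit (1 - z • C)) :
    IsResolventAt A z (-(C * Ring.inverse (1 - z • C))) := by
  constructor
  · intro y
    obtain ⟨h1, h2⟩ := h.exists_mem (-(Ring.inverse (1 - z • C) y))
    have e : (-(C * Ring.inverse (1 - z • C))) y = C (-(Ring.inverse (1 - z • C) y)) := by
      rw [map_neg]; rfl
    simp only [e]
    refine ⟨h1, ?_⟩
    rw [h2, map_neg]
    have := DFunLike.congr_fun (Ring.mul_inverse_cancel _ hz) y
    change Ring.inverse (1 - z • C) y - z • C (Ring.inverse (1 - z • C) y) = y at this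
    rw [smul_neg, sub_neg_eq_add, neg_add_eq_sub]
    exact this
  · intro x
    have e : z • (x : F) - A x = -((1 - z • C) (A x)) := by
      change _ = -(A x - z • C (A x))
      rw [h.apply_self, neg_sub]
    have := DFunLike.congr_fun (Ring.inverse_mul_cancel _ hz) (A x)
    change -(C (Ring.inverse (1 - z • C) _)) = x
    rw [e, map_neg, map_neg, neg_neg]
    exact (congrArg C this).trans (h.apply_self x)

lemma opResolvent_eq (h : IsInverse A C) {z : ℂ} (hz : IsUnit (1 - z • C)) :
    opResolvent A z = -(C * Ring.inverse (1 - z • C)) := by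
  have h1 := h.isResolventAt hz
  have hex : ∃ R, IsResolventAt A z R := ⟨_, h1⟩
  rw [opResolvent, dif_pos hex, ← sub_eq_zero, hex.choose_spec.sub_eq h1, sub_self, zero_smul]

lemma eq_zero_of_mem_resolventSet (h : IsInverse A C) {z : ℂ} (hz : z ∈ resolventSet A) {y : F}
    (hy : z • C y = y) : y = 0 := by
  obtain ⟨R, hR⟩ := hz
  obtain ⟨h1, h2⟩ := h.exists_mem y
  have h3 := hR.2 ⟨C y, h1⟩
  rw [h2] at h3
  simp only [hy, sub_self, map_zero] at h3
  exact h.injective h3.symm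

lemma mem_resolventSet_iff [CompleteSpace F] (h : IsInverse A C) (hC : IsCompactOperator C)
    {z : ℂ} : z ∈ resolventSet A ↔ IsUnit (1 - z • C) :=
  ⟨fun hz => isUnit_one_sub_of_injective (hC.smul z) fun _ hy =>
      h.eq_zero_of_mem_resolventSet hz hy,
    fun hz => ⟨_, h.isResolventAt hz⟩⟩

lemma mem_resolventSet_of_injective [CompleteSpace F] (h : IsInverse A C)
    (hC : IsCompactOperator C) {z : ℂ} (hz : ∀ y, z • C y = y → y = 0) : z ∈ resolventSet A :=
  (h.mem_resolventSet_iff hC).2 (isUnit_one_sub_of_injective (hC.smul z) hz)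

lemma isEigenvalue [CompleteSpace F] (h : IsInverse A C) (hC : IsCompactOperator C) {z : ℂ}
    (hz : z ∈ opSpectrum A) : IsEigenvalue A z := by
  by_contra hcon
  refine hz (h.mem_resolventSet_of_injective hC fun y hy => ?_)
  by_contra hy0
  obtain ⟨h1, h2⟩ := h.exists_mem y
  refine hcon ⟨⟨C y, h1⟩, fun h0 => hy0 (h.injective h0), ?_⟩
  rw [h2]; exact hy.symm

end IsInverse

end Inverse

/-! ### The resolvent near a spectral point and the rank of the Riesz projection. -/

lemma differentiableAt_ringInverse_one_sub_smul_add {C P : E →L[ℂ] E} {z : ℂ}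
    (hz : IsUnit (1 - z • C + P)) :
    DifferentiableAt ℂ (fun z : ℂ => Ring.inverse (1 - z • C + P)) z :=
  (differentiableAt_inverse hz).comp z (f := fun z : ℂ => 1 - z • C + P) (by fun_prop)

lemma circleIntegral_mul_const {f : ℂ → E →L[ℂ] E} {c : ℂ} {r : ℝ} (hf : CircleIntegrable f c r)
    (T : E →L[ℂ] E) : (∮ z in C(c, r), f z) * T = ∮ z in C(c, r), f z * T := by
  have h := ((ContinuousLinearMap.mul ℂ (E →L[ℂ] E)).flip T).intervalIntegral_comp_comm hf.out
  simpa [circleIntegral] using h.symm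

/-- An operator with a compact inverse has discrete spectrum. -/
theorem IsInverse.isDiscreteEigenvalue {A : E →ₗ.[ℂ] E} {C : E →L[ℂ] E} (h : IsInverse A C)
    (hC : IsCompactOperator C) {c : ℂ} (hc : c ∈ opSpectrum A) : IsDiscreteEigenvalue A c := by
  refine ⟨h.isEigenvalue hC hc, ?_⟩
  have hcC : IsCompactOperator (c • C : E →L[ℂ] E) := hC.smul c
  obtain ⟨n, P, hfin, hPP, hnil, hPker, hcomm⟩ := exists_riesz_projection hcC
  set S : E →L[ℂ] E := 1 - c • C with hS
  have hCP : Commute C P := hcomm C ((Commute.refl C).smul_right c)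
  have hSP : Commute S P := (Commute.one_left P).sub_left (hCP.smul_left c)
  have hpow : ∀ {a : ℂ} {x : E} (k : ℕ), S x = a • x → (S ^ k) x = a ^ k • x := by
    intro a x k hx
    induction k with
    | zero => simp
    | succ k ih => rw [pow_succ, mul_apply_eq_comp, hx, map_smul, ih, smul_smul, pow_succ']
  have hP0 : ∀ {a : ℂ} {x : E}, a ≠ 0 → S x = a • x → P x = 0 := by
    intro a x ha hx
    have h1 : S (P x) = a • P x := by
      rw [← map_smul, ← hx]; exact DFunLike.congr_fun hSP.eq x
    have h2 := hpow n h1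
    rw [hnil] at h2
    exact (smul_eq_zero.1 h2.symm).resolve_left (pow_ne_zero n ha)
  have hPc : IsCompactOperator P :=
    isCompactOperator_of_range_le (V := LinearMap.range P.toLinearMap) fun x => ⟨x, rfl⟩
  -- If `S x + P x = 0`, applying `P` gives `S (P x) = -P x`. But `S` is nilpotent on the range of
  -- `P`, so `P x = 0`; then `S x = 0` and `x = P x = 0`.
  have hunit : IsUnit (1 - c • C + P) := by
    rw [show 1 - c • C + P = 1 - (c • C - P) by abel]
    refine isUnit_one_sub_of_injective (hcC.sub hPc) fun x hx => ?_
    have h1 : S x + P x = 0 := by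
      change x - c • C x + P x = 0
      change c • C x - P x = x at hx
      rw [← neg_eq_zero, ← sub_eq_zero.2 hx]; abel
    have h2 : S (P x) = (-1 : ℂ) • P x := by
      have := congrArg P (eq_neg_of_add_eq_zero_left h1)
      rw [map_neg, ← mul_apply_eq_comp P P, hPP] at this
      rw [neg_one_smul, ← this]; exact DFunLike.congr_fun hSP.eq x
    have h3 : P x = 0 := by
      rw [← hPP]; exact hP0 (by norm_num) h2
    rw [h3, add_zero] at h1
    rw [← hPker x h1, h3]
  have hopen : IsOpen {z : ℂ | IsUnit (1 - z • C + P)} :=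
    Units.isOpen.preimage (f := fun z : ℂ => 1 - z • C + P) (by fun_prop)
  obtain ⟨r, hr, hball⟩ := Metric.nhds_basis_closedBall.mem_iff.1 (hopen.mem_nhds hunit)
  -- A solution of `z C x = x` is an eigenvector of `S` for `1 - c/z ≠ 0`, hence is killed by `P`.
  -- It then lies in the kernel of the invertible `1 - z C + P`.
  have hres : ∀ z ∈ Metric.closedBall c r, z ≠ c → IsUnit (1 - z • C) := by
    intro z hz hzc
    refine isUnit_one_sub_of_injective (hC.smul z) fun x hx => ?_
    change z • C x = x at hx
    have hz0 : z ≠ 0 ∨ x = 0 := by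
      by_contra! h0
      rw [h0.1, zero_smul] at hx
      exact h0.2 hx.symm
    rcases hz0 with hz0 | hx0
    · have h1 : S x = (1 - c / z) • x := by
        change x - c • C x = _
        rw [sub_smul, one_smul, div_eq_mul_inv, mul_smul]
        conv_rhs => rw [← hx, inv_smul_smul₀ hz0, hx]
      have h2 : P x = 0 :=
        hP0 (sub_ne_zero.2 fun h0 => hzc ((div_eq_one_iff_eq hz0).1 h0.symm).symm) h1
      obtain ⟨u, hu⟩ := hball hz
      have h3 : u.1 x = 0 := by
        rw [hu]
        change x - z • C x + P x = 0
        rw [hx, h2, sub_self, zero_add]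
      have h4 : x = u⁻¹.1 (u.1 x) := by
        rw [← mul_apply_eq_comp, Units.inv_mul]; rfl
      rw [h4, h3, map_zero]
    · exact hx0
  refine ⟨r, hr, ?_, ?_⟩
  · ext z
    constructor
    · rintro ⟨hz1, hz2⟩
      by_contra hzc
      exact hz2 ((h.mem_resolventSet_iff hC).2 (hres z hz1 hzc))
    · rintro rfl
      exact ⟨Metric.mem_closedBall_self hr.le, hc⟩
  have hsph : ∀ z ∈ Metric.sphere c r, IsUnit (1 - z • C) := fun z hz =>
    hres z (Metric.sphere_subset_closedBall hz) (Metric.ne_of_mem_sphere hz hr.ne')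
  have hint : CircleIntegrable (opResolvent A) c r := by
    refine ContinuousOn.circleIntegrable hr.le (ContinuousOn.congr (f :=
      fun z => -(C * Ring.inverse (1 - z • C + 0))) (fun z hz => ?_) fun z hz => ?_)
    · have := differentiableAt_ringInverse_one_sub_smul_add (C := C) (P := 0) (z := z)
        (by simpa using hsph z hz)
      exact (continuousAt_const.mul this.continuousAt).neg.continuousWithinAt
    · simp only [add_zero, h.opResolvent_eq (hsph z hz)]
  -- Adding `P` changes nothing on the range of `1 - P`. The right side is analytic on the whole
  -- closed disc, including `c`, so Cauchy's theorem makes its integral vanish.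
  have hreg : ∀ z ∈ Metric.sphere c r, opResolvent A z * (1 - P)
      = -(C * Ring.inverse (1 - z • C + P)) * (1 - P) := by
    intro z hz
    have hz1 := hsph z hz
    have hz2 : IsUnit (1 - z • C + P) := hball (Metric.sphere_subset_closedBall hz)
    rw [h.opResolvent_eq hz1, neg_mul, neg_mul, mul_assoc, mul_assoc]
    congr 2
    have hcom : Commute (1 - P) (1 - z • C + P) := by
      refine (Commute.one_left _).sub_left ?_
      exact ((Commute.one_right P).sub_right (hCP.symm.smul_right z)).add_right (Commute.refl P)
    have e1 : (1 - z • C) * (1 - P) = (1 - z • C + P) * (1 - P) := by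
      rw [add_mul, mul_sub P, hPP, mul_one, sub_self, add_zero]
    have e2 : (1 - P) * Ring.inverse (1 - z • C + P) = Ring.inverse (1 - z • C + P) * (1 - P) := by
      obtain ⟨u, hu⟩ := hz2
      rw [← hu] at hcom ⊢
      rw [Ring.inverse_unit]
      exact hcom.units_inv_right.eq
    calc Ring.inverse (1 - z • C) * (1 - P)
        = Ring.inverse (1 - z • C) * ((1 - P) *
            ((1 - z • C + P) * Ring.inverse (1 - z • C + P))) := by
          rw [Ring.mul_inverse_cancel _ hz2, mul_one]
      _ = Ring.inverse (1 - z • C) * (((1 - z • C) * (1 - P)) * Ring.inverse (1 - z • C + P)) := by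
          rw [← mul_assoc (1 - P), hcom.eq, e1]
      _ = (1 - P) * Ring.inverse (1 - z • C + P) := by
          rw [mul_assoc, ← mul_assoc, Ring.inverse_mul_cancel _ hz1, one_mul]
      _ = Ring.inverse (1 - z • C + P) * (1 - P) := e2
  have hzero : rieszProjection A c r * (1 - P) = 0 := by
    rw [rieszProjection, smul_mul_assoc, circleIntegral_mul_const hint,
      circleIntegral.integral_congr hr.le hreg]
    have hd : ∀ z ∈ Metric.closedBall c r, DifferentiableAt ℂ
        (fun z => -(C * Ring.inverse (1 - z • C + P)) * (1 - P)) z := fun z hz =>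
      (((differentiableAt_const C).mul
        (differentiableAt_ringInverse_one_sub_smul_add (hball hz))).neg.mul
        (differentiableAt_const _))
    rw [Complex.circleIntegral_eq_zero_of_differentiable_on_off_countable hr.le countable_empty
      (fun z hz => (hd z hz).continuousAt.continuousWithinAt)
      (fun z hz => hd z (Metric.ball_subset_closedBall hz.1)), smul_zero]
  have heq : rieszProjection A c r = rieszProjection A c r * P := by
    rw [mul_sub, mul_one, sub_eq_zero] at hzero
    exact hzero
  rw [heq]
  have : LinearMap.range (rieszProjection A c r * P).toLinearMap
      = (LinearMap.range P.toLinearMap).map (rieszProjection A c r).toLinearMap :=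
    LinearMap.range_comp _ _
  rw [this]
  infer_instance

end DampedWave

namespace DampedWave

/-! ## Dissipative operators with a compact inverse -/

section Dissipative

variable {E : Type*} [NormedAddCommGroup E] [InnerProductSpace ℂ E] {A : E →ₗ.[ℂ] E}

/-- `A` is dissipative. -/
def IsDissipative (A : E →ₗ.[ℂ] E) : Prop := ∀ x : A.domain, RCLike.re ⟪(x : E), A x⟫_ℂ ≤ 0

/-- Cauchy–Schwarz applied to `Re ⟨x, (l - A) x⟩ ≥ l ‖x‖²`. For `l > 0` this gives both injectivity
and the resolvent bound `1/l`. -/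
lemma IsDissipative.mul_norm_le (hA : IsDissipative A) {l : ℝ} (x : A.domain) :
    l * ‖(x : E)‖ ≤ ‖(l : ℂ) • (x : E) - A x‖ := by
  rcases (norm_nonneg (x : E)).eq_or_lt with h0 | h0
  · rw [← h0, mul_zero]; exact norm_nonneg _
  have h1 : RCLike.re ⟪(x : E), (l : ℂ) • (x : E) - A x⟫_ℂ
      = l * ‖(x : E)‖ ^ 2 - RCLike.re ⟪(x : E), A x⟫_ℂ := by
    rw [inner_sub_right, inner_smul_right, map_sub, RCLike.re_to_complex, Complex.re_ofReal_mul,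
      ← RCLike.re_to_complex, inner_self_eq_norm_sq]
  have h2 := re_inner_le_norm (𝕜 := ℂ) (x : E) ((l : ℂ) • (x : E) - A x)
  have h3 := hA x
  refine le_of_mul_le_mul_right ?_ h0
  nlinarith

/-- If `y` is orthogonal to the domain, then `0 = Re ⟨R y, y⟩ ≥ ‖R y‖²` because `y = (1 - A) R y`.
So `R y = 0` and `y = 0`. -/
lemma IsDissipative.dense_domain [CompleteSpace E] (hA : IsDissipative A) {R : E →L[ℂ] E}
    (hR : IsResolventAt A 1 R) : Dense (A.domain : Set E) := by
  rw [Submodule.dense_iff_topologicalClosure_eq_top, Submodule.topologicalClosure_eq_top_iff,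
    Submodule.eq_bot_iff]
  intro y hy
  obtain ⟨hm, he⟩ := hR.1 y
  have h1 : ⟪R y, y⟫_ℂ = 0 := (Submodule.mem_orthogonal _ _).1 hy _ hm
  have h2 : RCLike.re ⟪R y, y⟫_ℂ = ‖R y‖ ^ 2 - RCLike.re ⟪R y, A ⟨R y, hm⟩⟫_ℂ := by
    rw [← inner_self_eq_norm_sq (𝕜 := ℂ), ← map_sub, ← inner_sub_right]
    rw [one_smul] at he
    rw [he]
  rw [h1, map_zero] at h2
  have h3 := hA ⟨R y, hm⟩
  have h4 : R y = 0 := by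
    rw [← norm_eq_zero, ← sq_eq_zero_iff]
    simp only at h3
    nlinarith [sq_nonneg ‖R y‖]
  have h5 : (⟨R y, hm⟩ : A.domain) = 0 := Subtype.ext h4
  rw [← he, h5, A.map_zero, h4]; simp

/-- A dissipative operator with a compact inverse generates a contraction semigroup. -/
theorem IsInverse.exists_contractionSemigroup [CompleteSpace E] {C : E →L[ℂ] E}
    (h : IsInverse A C) (hC : IsCompactOperator C) (hA : IsDissipative A) :
    ∃ S : ℝ≥0 → E →L[ℂ] E, IsContractionSemigroup S ∧ IsGenerator A S := by
  have hex : ∀ n : ℕ, ∃ R, IsResolventAt A ((n : ℂ) + 1) R := by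
    intro n
    refine h.mem_resolventSet_of_injective hC fun y hy => ?_
    obtain ⟨hm, he⟩ := h.exists_mem y
    have h1 := hA.mul_norm_le (l := (n : ℝ) + 1) ⟨C y, hm⟩
    have h2 : (((n : ℝ) + 1 : ℝ) : ℂ) • C y = y := by push_cast; exact hy
    rw [he] at h1
    simp only [h2, sub_self, norm_zero] at h1
    have h3 : (0 : ℝ) < (n : ℝ) + 1 := by positivity
    exact h.injective (norm_le_zero_iff.1 (nonpos_of_mul_nonpos_right h1 h3))
  choose R hR using hex
  refine DampedWave.exists_contractionSemigroup hR (fun n => ?_)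
    (hA.dense_domain (R := R 0) (by simpa using hR 0))
  have h3 : (0 : ℝ) < (n : ℝ) + 1 := by positivity
  refine ContinuousLinearMap.opNorm_le_bound _ (by positivity) fun y => ?_
  obtain ⟨hm, he⟩ := (hR n).1 y
  have h1 := hA.mul_norm_le (l := (n : ℝ) + 1) ⟨R n y, hm⟩
  have h2 : (((n : ℝ) + 1 : ℝ) : ℂ) • R n y - A ⟨R n y, hm⟩ = y := by push_cast; exact he
  simp only [h2] at h1
  rwa [inv_mul_eq_div, le_div_iff₀' h3]

end Dissipative

/-! ## The space `W_0^{1,2}` -/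

lemma IsTestFun.conj {φ : ℝ → ℂ} (h : IsTestFun φ) : IsTestFun (fun x => conj (φ x)) :=
  ⟨Complex.conjCLE.contDiff.comp h.smooth, h.compact.comp_left (g := conj) (by simp),
    (tsupport_comp_subset (g := conj) (by simp) φ).trans h.supp⟩

lemma deriv_conj_apply (φ : ℝ → ℂ) (x : ℝ) :
    deriv (fun x => conj (φ x)) x = conj (deriv φ x) := deriv.star

namespace H10

/-- The embedding of `W_0^{1,2}` into `L²`. -/
def embed : H10 →L[ℂ] L2 :=
  (W012.subtype ∘ₗ H10.equiv.toLinearMap).mkContinuous 2 fun u => by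
    rw [H10.norm_def]; exact H10.poincare u

lemma embed_injective {u : H10} (h : embed u = 0) : u = 0 :=
  H10.equiv.map_eq_zero_iff.1 (Subtype.ext h)

/-- The derivative `W_0^{1,2} → L²`, as a continuous map. -/
def derivL : H10 →L[ℂ] L2 :=
  H10.D.mkContinuous 1 fun u => by rw [H10.norm_def, one_mul]

lemma hasWeakDeriv (u : H10) : HasWeakDeriv (embed u) (derivL u) :=
  hasWeakDeriv_weakDeriv₀ (H10.equiv u)

lemma inner_eq (u v : H10) : ⟪u, v⟫_ℂ = ⟪derivL u, derivL v⟫_ℂ := rfl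

lemma norm_eq (u : H10) : ‖u‖ = ‖derivL u‖ := H10.norm_def u

/-- Multiplication by `1 / x`, from `W_0^{1,2}` to `L²`. -/
def hardy : H10 →L[ℂ] L2 :=
  (divX ∘ₗ H10.equiv.toLinearMap).mkContinuous 2 fun u => by
    have h := hardy_closure (mem_closure_of_W012 (H10.equiv u))
    have h2 : ‖divX (H10.equiv u)‖
        = (eLpNorm (fun x => (H10.equiv u : L2) x / (x : ℂ)) 2 muI).toReal :=
      Lp.norm_toLp _ (memLp_div (H10.equiv u))
    change ‖divX (H10.equiv u)‖ ≤ _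
    rw [h2, H10.norm_def]
    have := ENNReal.toReal_mono (ENNReal.mul_ne_top (by simp) (Lp.memLp _).2.ne) h
    rwa [ENNReal.toReal_mul, ENNReal.toReal_ofNat] at this

lemma hardy_coeFn (u : H10) : hardy u =ᵐ[muI] fun x => embed u x / (x : ℂ) :=
  (memLp_div (H10.equiv u)).coeFn_toLp

/-- The inner product is `∫ |u|²/x`; this sign makes the damping dissipative. -/
lemma re_inner_embed_hardy_nonneg (u : H10) : 0 ≤ RCLike.re ⟪embed u, hardy u⟫_ℂ := by
  have h : ⟪embed u, hardy u⟫_ℂ = ((∫ x in Ioo (0 : ℝ) 1, ‖embed u x‖ ^ 2 / x : ℝ) : ℂ) := by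
    rw [L2.inner_def, ← integral_complex_ofReal]
    refine integral_congr_ae ?_
    filter_upwards [hardy_coeFn u] with x hx
    rw [hx, RCLike.inner_apply]
    push_cast
    rw [← Complex.mul_conj']
    ring
  rw [h, RCLike.re_to_complex, Complex.ofReal_re]
  refine setIntegral_nonneg measurableSet_Ioo fun x hx => ?_
  exact div_nonneg (sq_nonneg _) hx.1.le

lemma exists_test {φ : ℝ → ℂ} (hφ : IsTestFun φ) :
    ∃ u : H10, embed u = hφ.memLp.toLp φ ∧ derivL u = hφ.deriv.memLp.toLp (deriv φ) := by
  have h1 : (hφ.memLp.toLp φ, hφ.deriv.memLp.toLp (deriv φ)) ∈ testPairs.topologicalClosure :=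
    subset_closure ⟨φ, hφ, hφ.memLp.coeFn_toLp, hφ.deriv.memLp.coeFn_toLp⟩
  have h2 := hasWeakDeriv_of_mem_closure h1
  refine ⟨H10.equiv.symm ⟨_, mem_W012_iff.2 ⟨_, h2, h1⟩⟩, rfl, ?_⟩
  exact (H10.hasWeakDeriv _).unique h2

/-- The test functions in `W_0^{1,2}`. -/
def testSet : Set H10 :=
  {u | ∃ φ, IsTestFun φ ∧ embed u =ᵐ[muI] φ ∧ derivL u =ᵐ[muI] deriv φ}

lemma dense_testSet : Dense testSet := by
  intro u
  rw [Metric.mem_closure_iff]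
  intro ε hε
  obtain ⟨p, ⟨φ, hφ, h1, h2⟩, hp⟩ :=
    Metric.mem_closure_iff.1 (mem_closure_of_W012 (H10.equiv u)) ε hε
  obtain ⟨v, hv1, hv2⟩ := exists_test hφ
  refine ⟨v, ⟨φ, hφ, ?_, ?_⟩, ?_⟩
  · rw [hv1]; exact hφ.memLp.coeFn_toLp
  · rw [hv2]; exact hφ.deriv.memLp.coeFn_toLp
  · have h3 : p.2 = derivL v := by
      rw [hv2]; exact Lp.ext (h2.trans hφ.deriv.memLp.coeFn_toLp.symm)
    rw [dist_eq_norm, norm_eq, map_sub, ← dist_eq_norm, ← h3]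
    exact (le_max_right _ _).trans_lt hp

lemma inner_eq_integral {φ : ℝ → ℂ} {a : L2} (ha : a =ᵐ[muI] φ) (f : L2) :
    ⟪a, f⟫_ℂ = ∫ x in Ioo (0 : ℝ) 1, f x * conj (φ x) := by
  rw [L2.inner_def]
  refine integral_congr_ae ?_
  filter_upwards [ha] with x hx
  rw [hx, RCLike.inner_apply]

/-- Weak derivatives, tested against `W_0^{1,2}`. -/
lemma hasWeakDeriv_iff {f g : L2} :
    HasWeakDeriv f g ↔ ∀ u : H10, ⟪derivL u, f⟫_ℂ = -⟪embed u, g⟫_ℂ := by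
  constructor
  · intro h u
    have hcl : IsClosed {u : H10 | ⟪derivL u, f⟫_ℂ = -⟪embed u, g⟫_ℂ} :=
      isClosed_eq (by fun_prop) (by fun_prop)
    refine hcl.closure_subset_iff.2 ?_ (dense_testSet u)
    rintro v ⟨φ, hφ, h1, h2⟩
    change ⟪derivL v, f⟫_ℂ = -⟪embed v, g⟫_ℂ
    rw [inner_eq_integral h1, inner_eq_integral h2, ← h _ hφ.conj]
    simp_rw [deriv_conj_apply]
  · intro h φ hφ
    -- The inner product conjugates its first argument, whereas the weak derivative pairs without
    -- conjugation.
    obtain ⟨u, hu1, hu2⟩ := exists_test hφ.conj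
    have h1 := h u
    rw [hu1, hu2, inner_eq_integral hφ.conj.memLp.coeFn_toLp,
      inner_eq_integral hφ.conj.deriv.memLp.coeFn_toLp] at h1
    simpa [deriv_conj_apply] using h1

/-- `J† g` is the solution `u ∈ W_0^{1,2}` of `-u'' = g`, where `J` is the embedding into `L²`. -/
lemma adjoint_embed_eq_iff {u : H10} {g : L2} :
    u = embed.adjoint g ↔ HasWeakDeriv (derivL u) (-g) := by
  rw [hasWeakDeriv_iff]
  constructor
  · rintro rfl w
    rw [← inner_eq, ContinuousLinearMap.adjoint_inner_right, inner_neg_right, neg_neg]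
  · intro h
    refine ext_inner_left ℂ fun w => ?_
    rw [ContinuousLinearMap.adjoint_inner_right, inner_eq, h, inner_neg_right, neg_neg]

lemma adjoint_embed_injective {g : L2} (h : embed.adjoint g = 0) : g = 0 := by
  have h1 := adjoint_embed_eq_iff.1 h.symm
  rw [map_zero] at h1
  exact neg_eq_zero.1 (h1.unique HasWeakDeriv.zero)

lemma mem_W22_iff {u : H10} : embed u ∈ W22 ↔ ∃ g, HasWeakDeriv (derivL u) g := by
  constructor
  · intro h
    have h1 := weakDeriv_mem_of_W22 ⟨embed u, h⟩
    exact h1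
  · rintro ⟨g, hg⟩
    exact ⟨⟨embed u, W012_le_W12 (H10.equiv u).2⟩, hg.mem, rfl⟩

lemma weakDeriv₂_eq {u : H10} {g : L2} (h : HasWeakDeriv (derivL u) g) (hu : embed u ∈ W22) :
    weakDeriv₂ ⟨embed u, hu⟩ = g :=
  weakDeriv_eq h

/-- The Dirichlet domain is the range of `J†`, so statements about second derivatives become
statements about bounded operators. -/
lemma mem_domD_iff {u : H10} : embed u ∈ domD ↔ ∃ g, u = embed.adjoint g := by
  constructor
  · rintro ⟨-, h⟩
    obtain ⟨g, hg⟩ := mem_W22_iff.1 h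
    exact ⟨-g, adjoint_embed_eq_iff.2 (by rwa [neg_neg])⟩
  · rintro ⟨g, hg⟩
    exact ⟨(H10.equiv u).2, mem_W22_iff.2 ⟨_, adjoint_embed_eq_iff.1 hg⟩⟩

lemma eq_adjoint_embed_weakDeriv₂ {u : H10} (hu : embed u ∈ W22) :
    u = embed.adjoint (-weakDeriv₂ ⟨embed u, hu⟩) := by
  obtain ⟨g, hg⟩ := mem_W22_iff.1 hu
  rw [weakDeriv₂_eq hg hu]
  exact adjoint_embed_eq_iff.2 (by rwa [neg_neg])

lemma weakDeriv₂_adjoint_embed (g : L2) (hu : embed (embed.adjoint g) ∈ W22) :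
    weakDeriv₂ ⟨embed (embed.adjoint g), hu⟩ = -g :=
  weakDeriv₂_eq (adjoint_embed_eq_iff.1 rfl) hu

lemma test_mem_W22 {u : H10} (hu : u ∈ testSet) : embed u ∈ W22 := by
  obtain ⟨φ, hφ, h1, h2⟩ := hu
  obtain ⟨v, hv1, hv2⟩ := exists_test hφ.deriv
  refine mem_W22_iff.2 ⟨derivL v, ?_⟩
  have : derivL u = embed v := by
    rw [hv1]; exact Lp.ext (h2.trans hφ.deriv.memLp.coeFn_toLp.symm)
  rw [this]
  exact H10.hasWeakDeriv v

end H10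

end DampedWave

namespace DampedWave

namespace H10

/-! ## Compactness of the embedding `W_0^{1,2} → L²` -/

/-- The indicator function of `(a, b]`, in `L²`. -/
def indIoc (a b : ℝ) : L2 :=
  indicatorConstLp 2 (measurableSet_Ioc (a := a) (b := b)) (measure_ne_top muI _) 1

lemma norm_indIoc_le {a b : ℝ} (hab : a ≤ b) : ‖indIoc a b‖ ≤ √(b - a) := by
  rw [indIoc, norm_indicatorConstLp (by norm_num) (by norm_num), norm_one, one_mul,
    ENNReal.toReal_ofNat, ← Real.sqrt_eq_rpow]
  refine Real.sqrt_le_sqrt ?_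
  have h1 : muI (Ioc a b) ≤ volume (Ioc a b) := Measure.restrict_apply_le _ _
  have h2 := ENNReal.toReal_mono (by simp) h1
  rwa [Real.volume_Ioc, ENNReal.toReal_ofReal (sub_nonneg.2 hab)] at h2

lemma inner_indIoc {φ : ℝ → ℂ} (hφ : IsTestFun φ) {f : L2} (hf : f =ᵐ[muI] deriv φ) {a b : ℝ}
    (ha : 0 ≤ a) (hab : a ≤ b) (hb : b < 1) : ⟪indIoc a b, f⟫_ℂ = φ b - φ a := by
  rw [indIoc, L2.inner_indicatorConstLp_one, setIntegral_congr_ae measurableSet_Ioc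
    (g := deriv φ) (by filter_upwards [hf] with x hx _ using hx),
    Measure.restrict_restrict measurableSet_Ioc, inter_eq_left.2,
    ← intervalIntegral.integral_of_le hab,
    intervalIntegral.integral_deriv_eq_sub (fun x _ => hφ.differentiable x)
      (hφ.deriv.smooth.continuous.intervalIntegrable _ _)]
  exact fun x hx => ⟨ha.trans_lt hx.1, hx.2.trans_lt hb⟩

/-- Sampling at the points `k / N`: `u` is replaced with a step function. -/
def sample (N : ℕ) : H10 →L[ℂ] L2 :=
  ∑ k ∈ Finset.range N, ((innerSL ℂ (indIoc 0 (k / N))).comp derivL).smulRight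
    (indIoc (k / N) ((k + 1) / N))

/-- For a test function the coefficient is its value at `k / N`, by integrating the derivative from
`0`. The form used here is bounded on all of `W_0^{1,2}`. -/
lemma sample_apply (N : ℕ) (u : H10) : sample N u =
    ∑ k ∈ Finset.range N, ⟪indIoc 0 (k / N), derivL u⟫_ℂ • indIoc (k / N) ((k + 1) / N) := by
  rw [sample, _root_.sum_apply]
  rfl

lemma isCompactOperator_sample (N : ℕ) : IsCompactOperator (sample N) := by
  let V := Submodule.span ℂ ((fun k : ℕ => indIoc (k / N) ((k + 1) / N)) '' Finset.range N)
  have : FiniteDimensional ℂ V :=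
    FiniteDimensional.span_of_finite ℂ ((Finset.range N).finite_toSet.image _)
  refine isCompactOperator_of_range_le (V := V) fun u => ?_
  rw [sample_apply]
  exact Submodule.sum_mem _ fun k hk => Submodule.smul_mem _ _ (Submodule.subset_span ⟨k, hk, rfl⟩)

/-- With half-open cells, `k = ⌈N x⌉ - 1` is the only possible index. -/
lemma exists_mem_Ioc_div {N : ℕ} (hN : 0 < N) {x : ℝ} (hx : x ∈ Ioo (0 : ℝ) 1) :
    ∃ k ∈ Finset.range N, x ∈ Ioc ((k : ℝ) / N) ((k + 1) / N) ∧
      ∀ j ∈ Finset.range N, j ≠ k → x ∉ Ioc ((j : ℝ) / N) ((j + 1) / N) := by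
  have hN' : (0 : ℝ) < N := by exact_mod_cast hN
  have hpos : 0 < N * x := mul_pos hN' hx.1
  obtain ⟨k, hk⟩ : ∃ k : ℕ, ⌈N * x⌉₊ = k + 1 :=
    Nat.exists_eq_succ_of_ne_zero (Nat.ceil_pos.2 hpos).ne'
  have hkx := (Nat.ceil_eq_iff (Nat.succ_ne_zero k)).1 hk
  have key : ∀ j : ℕ, x ∈ Ioc ((j : ℝ) / N) ((j + 1) / N) ↔ ⌈N * x⌉₊ = j + 1 := by
    intro j
    rw [Nat.ceil_eq_iff (Nat.succ_ne_zero j), mem_Ioc, div_lt_iff₀' hN', le_div_iff₀' hN']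
    simp
  refine ⟨k, ?_, (key k).2 hk, fun j _ hjk h => hjk ?_⟩
  · rw [Finset.mem_range]
    have h1 : (k : ℝ) < N * x := by simpa using hkx.1
    have h2 : (k : ℝ) < N := h1.trans (by nlinarith [hx.2])
    exact_mod_cast h2
  · have := (key j).1 h
    omega

lemma norm_embed_sub_sample_le {N : ℕ} (hN : 0 < N) (u : H10) :
    ‖embed u - sample N u‖ ≤ √(1 / N) * ‖u‖ := by
  have hcl : IsClosed {u : H10 | ‖embed u - sample N u‖ ≤ √(1 / N) * ‖u‖} :=
    isClosed_le (by fun_prop) (by fun_prop)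
  refine hcl.closure_subset_iff.2 ?_ (dense_testSet u)
  rintro v ⟨φ, hφ, h1, h2⟩
  change ‖embed v - sample N v‖ ≤ √(1 / N) * ‖v‖
  have hN' : (0 : ℝ) < N := by exact_mod_cast hN
  have hind : ∀ᵐ x ∂muI, ∀ k : ℕ, indIoc (k / N) ((k + 1) / N) x
      = (Ioc ((k : ℝ) / N) ((k + 1) / N)).indicator (fun _ => (1 : ℂ)) x :=
    ae_all_iff.2 fun k => indicatorConstLp_coeFn
  have hsm : ∀ᵐ x ∂muI, ∀ k : ℕ,
      (⟪indIoc 0 (k / N), derivL v⟫_ℂ • indIoc (k / N) ((k + 1) / N) : L2) x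
        = ⟪indIoc 0 (k / N), derivL v⟫_ℂ * indIoc (k / N) ((k + 1) / N) x :=
    ae_all_iff.2 fun k => Lp.coeFn_smul _ _
  have hsum : sample N v =ᵐ[muI] fun x => ∑ k ∈ Finset.range N,
      (⟪indIoc 0 (k / N), derivL v⟫_ℂ • indIoc (k / N) ((k + 1) / N) : L2) x := by
    rw [sample_apply]
    refine (Lp.coeFn_finsetSum _ _).trans (Eventually.of_forall fun x => ?_)
    rw [Finset.sum_apply]
  have hb : ∀ᵐ x ∂muI, ‖(embed v - sample N v : L2) x‖ ≤ √(1 / N) * ‖v‖ := by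
    filter_upwards [Lp.coeFn_sub (embed v) (sample N v), h1, hind, hsm, hsum,
      ae_restrict_mem measurableSet_Ioo] with x e1 e2 e3 e4 e5 hx
    obtain ⟨k, hk, hkx, hk'⟩ := exists_mem_Ioc_div hN hx
    have hs : sample N v x = φ (k / N) := by
      rw [e5, Finset.sum_eq_single_of_mem k hk fun j hj hjk => by
        rw [e4, e3, indicator_of_notMem (hk' j hj hjk), mul_zero], e4, e3,
        indicator_of_mem hkx, mul_one, inner_indIoc hφ h2 le_rfl (by positivity)
        (hkx.1.trans hx.2), hφ.eq_zero (x := 0) (by simp), sub_zero]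
    -- The increment `φ x - φ (k/N)` pairs `φ'` with the indicator of `(k/N, x]`, whose norm is at
    -- most `√(1/N)`. The pointwise bound becomes an `L²` bound because the interval has mass `1`.
    rw [e1, Pi.sub_apply, e2, hs, ← inner_indIoc hφ h2 (by positivity) hkx.1.le hx.2]
    refine (norm_inner_le_norm _ _).trans ?_
    rw [norm_eq]
    refine mul_le_mul_of_nonneg_right ((norm_indIoc_le hkx.1.le).trans (Real.sqrt_le_sqrt ?_))
      (norm_nonneg _)
    have := hkx.2
    rw [add_div] at this
    linarith
  have h3 := Lp.norm_le_of_ae_bound (by positivity) hb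
  have h4 : measureUnivNNReal muI = 1 := by simp [measureUnivNNReal]
  simpa [h4] using h3

/-- Rellich's theorem. -/
lemma isCompactOperator_embed : IsCompactOperator embed := by
  have h : Tendsto (fun N : ℕ => sample (N + 1)) atTop (𝓝 embed) := by
    refine (tendsto_iff_norm_sub_tendsto_zero (E := H10 →L[ℂ] L2)).2 ?_
    refine squeeze_zero (g := fun N : ℕ => √(1 / ((N : ℝ) + 1)))
      (fun _ => ContinuousLinearMap.opNorm_nonneg _)
      (fun N => ?_) ?_
    · refine ContinuousLinearMap.opNorm_le_bound _ (Real.sqrt_nonneg _) fun u => ?_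
      have := norm_embed_sub_sample_le N.succ_pos u
      rw [norm_sub_rev] at this
      exact_mod_cast this
    · have := (Real.continuous_sqrt.tendsto 0).comp
        (tendsto_one_div_add_atTop_nhds_zero_nat (𝕜 := ℝ))
      rwa [Real.sqrt_zero] at this
  exact isCompactOperator_of_tendsto h (Eventually.of_forall fun N => isCompactOperator_sample _)

end H10

/-- Schauder's theorem in Hilbert spaces. -/
lemma isCompactOperator_adjoint {E F : Type*} [NormedAddCommGroup E] [InnerProductSpace ℂ E]
    [CompleteSpace E] [NormedAddCommGroup F] [InnerProductSpace ℂ F] [CompleteSpace F]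
    {T : E →L[ℂ] F} (hT : IsCompactOperator T) : IsCompactOperator T.adjoint := by
  have hc : IsCompactOperator (T ∘L T.adjoint) := hT.comp_clm T.adjoint
  obtain ⟨Q, hQ, hQ'⟩ := hc.image_closedBall_subset_compact 1
  have htb : TotallyBounded (T.adjoint '' Metric.closedBall 0 1) := by
    rw [Metric.totallyBounded_iff]
    intro ε hε
    obtain ⟨t, ht, hfin, hcov⟩ := Metric.finite_approx_of_totallyBounded
      (hQ.totallyBounded.subset hQ') (ε ^ 2 / 2) (by positivity)
    obtain ⟨t', ht', hfin', rfl⟩ := exists_subset_image_finite_and.1 ⟨t, ht, hfin, rfl⟩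
    refine ⟨T.adjoint '' t', hfin'.image _, ?_⟩
    rintro _ ⟨g, hg, rfl⟩
    have h1 := hcov ⟨g, hg, rfl⟩
    simp only [mem_iUnion, mem_image, Metric.mem_ball, exists_prop,
      exists_exists_and_eq_and] at h1 ⊢
    obtain ⟨k, hk, h1⟩ := h1
    refine ⟨k, hk, ?_⟩
    rw [dist_eq_norm, ← map_sub] at h1 ⊢
    -- As `‖g - k‖ ≤ 2`, an `ε²/2`-net for `T T†` yields an `ε`-net for `T†`.
    have h2 : ‖T.adjoint (g - k)‖ ^ 2 ≤ ‖g - k‖ * ‖(T ∘L T.adjoint) (g - k)‖ := by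
      rw [← inner_self_eq_norm_sq (𝕜 := ℂ), ContinuousLinearMap.adjoint_inner_left]
      exact re_inner_le_norm _ _
    have h3 : ‖g - k‖ ≤ 2 := by
      have := norm_sub_le g k
      have h4 := mem_closedBall_zero_iff.1 hg
      have h5 := mem_closedBall_zero_iff.1 (ht' hk)
      linarith
    refine lt_of_pow_lt_pow_left₀ 2 hε.le ?_
    change ‖(T ∘L T.adjoint) (g - k)‖ < ε ^ 2 / 2 at h1
    nlinarith [norm_nonneg (g - k), norm_nonneg ((T ∘L T.adjoint) (g - k))]
  refine ⟨closure (T.adjoint '' Metric.closedBall 0 1),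
    htb.closure.isCompact_of_isClosed isClosed_closure, ?_⟩
  exact mem_of_superset (Metric.closedBall_mem_nhds 0 one_pos) fun x hx =>
    subset_closure ⟨x, hx, rfl⟩

end DampedWave

namespace DampedWave

/-! ### The compact inverse of `G`. -/

open H10 in
/-- The operator `q + 2 α p / x` of `(p, q) ∈ ℋ`. -/
def forcing (α : ℝ) : Hsp →L[ℂ] L2 :=
  WithLp.sndL 2 ℂ H10 L2 + (2 * α : ℂ) • (hardy ∘L WithLp.fstL 2 ℂ H10 L2)

/-- The inclusion of the first factor of `ℋ`. -/
def inclFst : H10 →L[ℂ] Hsp :=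
  (WithLp.prodContinuousLinearEquiv 2 ℂ H10 L2).symm.toContinuousLinearMap
    ∘L ContinuousLinearMap.inl ℂ H10 L2

/-- The inclusion of the second factor of `ℋ`. -/
def inclSnd : L2 →L[ℂ] Hsp :=
  (WithLp.prodContinuousLinearEquiv 2 ℂ H10 L2).symm.toContinuousLinearMap
    ∘L ContinuousLinearMap.inr ℂ H10 L2

/-- The inverse of `G`: it maps `(p, q)` to `(-J† (q + 2 α p / x), J p)`, where `J` is the embedding
of `W_0^{1,2}` into `L²`. -/
def invG (α : ℝ) : Hsp →L[ℂ] Hsp :=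
  inclSnd ∘L (H10.embed ∘L WithLp.fstL 2 ℂ H10 L2)
    - inclFst ∘L (H10.embed.adjoint ∘L forcing α)

lemma forcing_apply (α : ℝ) (y : Hsp) :
    forcing α y = y.snd + (2 * α : ℂ) • H10.hardy y.fst := rfl

lemma invG_apply (α : ℝ) (y : Hsp) :
    invG α y = WithLp.toLp 2 (-H10.embed.adjoint (forcing α y), H10.embed y.fst) := by
  change WithLp.toLp 2 ((0 : H10), H10.embed y.fst)
    - WithLp.toLp 2 (H10.embed.adjoint (forcing α y), (0 : L2)) = _
  rw [← WithLp.toLp_sub, Prod.mk_sub_mk, sub_zero, zero_sub]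

lemma isCompactOperator_invG (α : ℝ) : IsCompactOperator (invG α) := by
  have h1 : IsCompactOperator (inclFst ∘L (H10.embed.adjoint ∘L forcing α)) :=
    ((isCompactOperator_adjoint H10.isCompactOperator_embed).comp_clm (forcing α)).clm_comp inclFst
  have h2 : IsCompactOperator (inclSnd ∘L (H10.embed ∘L WithLp.fstL 2 ℂ H10 L2)) :=
    (H10.isCompactOperator_embed.comp_clm (WithLp.fstL 2 ℂ H10 L2)).clm_comp inclSnd
  exact h2.sub h1

lemma invG_injective (α : ℝ) {y : Hsp} (h : invG α y = 0) : y = 0 := by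
  rw [invG_apply] at h
  have h1 : -H10.embed.adjoint (forcing α y) = 0 := congrArg WithLp.fst h
  have h2 : H10.embed y.fst = 0 := congrArg WithLp.snd h
  have h3 := H10.embed_injective h2
  have h4 := H10.adjoint_embed_injective (neg_eq_zero.1 h1)
  rw [forcing_apply, h3, map_zero, smul_zero, add_zero] at h4
  exact WithLp.ofLp_injective 2 (Prod.ext h3 h4)

/-- Applying `forcing` to `G₀ (u, v)` cancels the damping term and leaves `u''`. -/
lemma eq_invG_of_mem_graph {α : ℝ} {w : Hsp × Hsp} (hw : w ∈ (G₀ α).graph) :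
    w.1 = invG α w.2 := by
  obtain ⟨x, hx, hy⟩ := (LinearPMap.mem_graph_iff _).1 hw
  have e1 : w.2.fst = H10.equiv.symm ⟨x.1.snd, x.2.2.1⟩ := by rw [← hy]; rfl
  have e2 : w.2.snd = weakDeriv₂ ⟨H10.equiv x.1.fst, x.2.1.2⟩
      - (2 * α : ℂ) • divX ⟨x.1.snd, x.2.2.1⟩ := by rw [← hy]; rfl
  have e3 : forcing α w.2 = weakDeriv₂ ⟨H10.equiv x.1.fst, x.2.1.2⟩ := by
    rw [forcing_apply, e1, e2]
    exact sub_add_cancel _ _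
  rw [invG_apply, e3, e1, ← hx, ← map_neg]
  refine WithLp.ofLp_injective 2 (Prod.ext ?_ rfl)
  exact H10.eq_adjoint_embed_weakDeriv₂ x.2.1.2

/-- The first component of `invG α y` is always in the Dirichlet domain. Only its second component,
`y.fst`, may lack a second derivative. -/
lemma mem_graph_of_mem_W22 {α : ℝ} {y : Hsp} (hy : H10.embed y.fst ∈ W22) :
    (invG α y, y) ∈ (G₀ α).graph := by
  have h1 : H10.embed (-H10.embed.adjoint (forcing α y)) ∈ domD :=
    H10.mem_domD_iff.2 ⟨-forcing α y, (map_neg _ _).symm⟩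
  have hm : invG α y ∈ (G₀ α).domain := by
    rw [invG_apply]
    exact ⟨h1, (H10.equiv y.fst).2, hy⟩
  refine (LinearPMap.mem_graph_iff _).2 ⟨⟨invG α y, hm⟩, rfl, ?_⟩
  have e : (⟨invG α y, hm⟩ : (G₀ α).domain) = ⟨WithLp.toLp 2 (-H10.embed.adjoint (forcing α y),
    H10.embed y.fst), by rw [← invG_apply]; exact hm⟩ := Subtype.ext (invG_apply α y)
  rw [e]
  refine WithLp.ofLp_injective 2 (Prod.ext rfl ?_)
  change weakDeriv₂ ⟨H10.embed (-H10.embed.adjoint (forcing α y)), h1.2⟩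
    - (2 * α : ℂ) • H10.hardy y.fst = y.snd
  have e2 : HasWeakDeriv (H10.derivL (-H10.embed.adjoint (forcing α y))) (forcing α y) := by
    rw [← neg_neg (forcing α y), ← H10.adjoint_embed_eq_iff, neg_neg, map_neg]
  rw [H10.weakDeriv₂_eq e2 h1.2, forcing_apply, add_sub_cancel_right]

/-- The right side is closed since `invG` is continuous, and it contains the graph. Conversely,
approximating `y.fst` by test functions gives points of the graph. Injectivity of `invG` then makes
the closure single-valued. -/
lemma mem_closure_graph_iff {α : ℝ} {w : Hsp × Hsp} :
    w ∈ (G₀ α).graph.topologicalClosure ↔ w.1 = invG α w.2 := by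
  constructor
  · intro h
    have hcl : IsClosed {w : Hsp × Hsp | w.1 = invG α w.2} :=
      isClosed_eq continuous_fst ((invG α).continuous.comp continuous_snd)
    exact hcl.closure_subset_iff.2 (fun w hw => eq_invG_of_mem_graph hw) h
  · rcases w with ⟨x, y⟩
    intro hxy
    obtain rfl : x = invG α y := hxy
    -- The second component keeps `forcing α (f u)` equal to `forcing α y`, so only the second
    -- component of `invG α (f u)` varies.
    let f : H10 → Hsp := fun u => WithLp.toLp 2 (u, forcing α y - (2 * α : ℂ) • H10.hardy u)
    have hf : Continuous f := by
      refine (WithLp.prod_continuous_toLp 2 H10 L2).comp (continuous_id.prodMk ?_)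
      fun_prop
    have hfy : f y.fst = y := by
      refine WithLp.ofLp_injective 2 (Prod.ext rfl ?_)
      change forcing α y - (2 * α : ℂ) • H10.hardy y.fst = y.snd
      rw [forcing_apply, add_sub_cancel_right]
    have h := map_mem_closure (f := fun u => (invG α (f u), f u))
      (t := ((G₀ α).graph : Set (Hsp × Hsp)))
      (((invG α).continuous.comp hf).prodMk hf) (H10.dense_testSet y.fst)
      (fun u hu => mem_graph_of_mem_W22 (H10.test_mem_W22 hu))
    simp only [hfy] at h
    exact h

lemma isClosable_G₀ (α : ℝ) : (G₀ α).IsClosable :=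
  ⟨_, (Submodule.toLinearPMap_graph_eq _ fun _ hw h0 => invG_injective α
    ((mem_closure_graph_iff.1 hw).symm.trans h0)).symm⟩

lemma isInverse_invG (α : ℝ) : IsInverse (G α) (invG α) := fun x y => by
  rw [G, ← (isClosable_G₀ α).graph_closure_eq_closure_graph, mem_closure_graph_iff]

/-- For `w = invG α (p, q)` the real parts of the pairings of `q` with `J p` cancel, leaving `-2α ∫
|p|²/x`. -/
lemma isDissipative_G {α : ℝ} (hα : 0 ≤ α) : IsDissipative (G α) := by
  intro x
  have hx := (isInverse_invG α).apply_self x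
  rw [← hx]
  set y := G α x
  rw [invG_apply, WithLp.prod_inner_apply]
  change RCLike.re (⟪-H10.embed.adjoint (forcing α y), y.fst⟫_ℂ + ⟪H10.embed y.fst, y.snd⟫_ℂ) ≤ 0
  rw [inner_neg_left, ContinuousLinearMap.adjoint_inner_left, forcing_apply, inner_add_left,
    inner_smul_left]
  have h1 := H10.re_inner_embed_hardy_nonneg y.fst
  rw [← inner_re_symm] at h1
  have h2 := inner_re_symm (𝕜 := ℂ) y.snd (H10.embed y.fst)
  have h3 : RCLike.re (conj (2 * α : ℂ) * ⟪H10.hardy y.fst, H10.embed y.fst⟫_ℂ)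
      = 2 * α * RCLike.re ⟪H10.hardy y.fst, H10.embed y.fst⟫_ℂ := by
    rw [show (2 * α : ℂ) = ((2 * α : ℝ) : ℂ) by push_cast; rfl, Complex.conj_ofReal,
      RCLike.re_to_complex, Complex.re_ofReal_mul]
    rfl
  rw [map_add, map_neg, map_add, h3, h2]
  have := mul_nonneg (mul_nonneg zero_le_two hα) h1
  linarith

/-! ## The operator `T` -/

/-- `T(z) (-d²/dx²)⁻¹`, a compact perturbation of the identity. -/
def reducedT (α : ℝ) (z : ℂ) : L2 →L[ℂ] L2 :=
  1 - (-((2 * z * α) • (H10.hardy ∘L H10.embed.adjoint)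
    + z ^ 2 • (H10.embed ∘L H10.embed.adjoint)))

lemma reducedT_apply (α : ℝ) (z : ℂ) (h : L2) :
    reducedT α z h = h + ((2 * z * α) • H10.hardy (H10.embed.adjoint h)
      + z ^ 2 • H10.embed (H10.embed.adjoint h)) := sub_neg_eq_add _ _

lemma isUnit_reducedT {α : ℝ} {z : ℂ} (h : ∀ y, reducedT α z y = 0 → y = 0) :
    IsUnit (reducedT α z) := by
  have hadj := isCompactOperator_adjoint H10.isCompactOperator_embed
  have h1 : IsCompactOperator ((2 * z * α) • (H10.hardy ∘L H10.embed.adjoint)) :=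
    (hadj.clm_comp H10.hardy).smul (2 * z * (α : ℂ))
  have h2 : IsCompactOperator (z ^ 2 • (H10.embed ∘L H10.embed.adjoint)) :=
    (hadj.clm_comp H10.embed).smul (z ^ 2)
  refine isUnit_one_sub_of_injective (h1.add h2).neg fun x hx => h x ?_
  change x - _ = 0
  exact sub_eq_zero.2 hx.symm

lemma adjoint_embed_mem_domD (h : L2) : H10.embed (H10.embed.adjoint h) ∈ domD :=
  H10.mem_domD_iff.2 ⟨h, rfl⟩

lemma T_apply (α : ℝ) (z : ℂ) (h : L2) :
    T α z ⟨H10.embed (H10.embed.adjoint h), adjoint_embed_mem_domD h⟩ = reducedT α z h := by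
  change -weakDeriv₂ ⟨H10.embed (H10.embed.adjoint h), (adjoint_embed_mem_domD h).2⟩
    + (2 * z * α) • H10.hardy (H10.embed.adjoint h) + z ^ 2 • H10.embed (H10.embed.adjoint h) = _
  rw [H10.weakDeriv₂_adjoint_embed, neg_neg, reducedT_apply, add_assoc]

lemma exists_adjoint_embed_eq (x : domD) : ∃ h, H10.embed (H10.embed.adjoint h) = x := by
  obtain ⟨g, hg⟩ := (H10.mem_domD_iff (u := H10.equiv.symm ⟨x, x.2.1⟩)).1 x.2
  exact ⟨g, by rw [← hg]; rfl⟩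

/-- Since `J J†` maps `L²` bijectively onto the domain and `T(z) J J†` is `reducedT`, inverting
`T(z)` means inverting `reducedT`, for which injectivity suffices. The minus sign below comes from
`0 - T(z)`. -/
lemma zero_mem_resolventSet_T_iff {α : ℝ} {z : ℂ} :
    (0 : ℂ) ∈ resolventSet (T α z) ↔ ∀ y, reducedT α z y = 0 → y = 0 := by
  constructor
  · rintro ⟨R, -, hR⟩ y hy
    have h1 := hR ⟨_, adjoint_embed_mem_domD y⟩
    rw [T_apply, hy] at h1
    simp only [zero_smul, sub_zero, map_zero] at h1
    exact H10.adjoint_embed_injective (H10.embed_injective h1.symm)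
  · intro h
    obtain ⟨u, hu⟩ := isUnit_reducedT h
    refine ⟨H10.embed ∘L H10.embed.adjoint ∘L (-u⁻¹.1), fun y => ⟨adjoint_embed_mem_domD _, ?_⟩,
      fun x => ?_⟩
    · rw [zero_smul, zero_sub]
      refine (congrArg Neg.neg (T_apply α z (-u⁻¹.1 y))).trans ?_
      rw [map_neg, neg_neg, ← hu, ← mul_apply_eq_comp, Units.mul_inv]
      rfl
    · obtain ⟨g, hg⟩ := exists_adjoint_embed_eq x
      have e : x = ⟨_, adjoint_embed_mem_domD g⟩ := Subtype.ext hg.symm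
      have hug : -u⁻¹.1 (-reducedT α z g) = g := by
        rw [map_neg, neg_neg, ← hu, ← mul_apply_eq_comp, Units.inv_mul]
        rfl
      rw [← hg, e, T_apply, zero_smul, zero_sub]
      exact congrArg (fun g => H10.embed (H10.embed.adjoint g)) hug

/-- For `y = (p, q)`, the equation `z • invG α y = y` says `q = z p` and `p = J† h` with `h = -z (q
+ 2αp/x)`. Substituting `q` gives `h + 2zα p/x + z² p = 0`, which is `reducedT α z h = 0`. -/
lemma injective_iff {α : ℝ} {z : ℂ} :
    (∀ y, z • invG α y = y → y = 0) ↔ ∀ h, reducedT α z h = 0 → h = 0 := by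
  constructor
  · intro H h hh
    rw [reducedT_apply] at hh
    let y : Hsp := WithLp.toLp 2 (H10.embed.adjoint h, z • H10.embed (H10.embed.adjoint h))
    have h1 : z • forcing α y = -h := by
      rw [eq_neg_iff_add_eq_zero, ← hh, forcing_apply]
      change z • (z • H10.embed (H10.embed.adjoint h)
        + (2 * α : ℂ) • H10.hardy (H10.embed.adjoint h)) + h = _
      module
    have h2 : z • invG α y = y := by
      rw [invG_apply, ← WithLp.toLp_smul, Prod.smul_mk, smul_neg, ← map_smul, h1, map_neg, neg_neg]
      rfl
    have h3 : H10.embed.adjoint h = 0 := congrArg WithLp.fst (H y h2)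
    exact H10.adjoint_embed_injective h3
  · intro H y hy
    rw [invG_apply, ← WithLp.toLp_smul, Prod.smul_mk] at hy
    have h1 : z • -H10.embed.adjoint (forcing α y) = y.fst := congrArg WithLp.fst hy
    have h2 : z • H10.embed y.fst = y.snd := congrArg WithLp.snd hy
    have h3 : H10.embed.adjoint (-(z • forcing α y)) = y.fst := by
      rw [← h1, map_neg, map_smul, smul_neg]
    have h4 : -(z • forcing α y) = 0 := by
      refine H _ ?_
      rw [reducedT_apply, h3, forcing_apply, ← h2]
      module
    rw [h4, map_zero] at h3
    rw [← h3, map_zero, smul_zero] at h2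
    exact WithLp.ofLp_injective 2 (Prod.ext h3.symm h2.symm)

lemma mem_opSpectrum_G_iff {α : ℝ} {z : ℂ} :
    z ∈ opSpectrum (G α) ↔ (0 : ℂ) ∈ opSpectrum (T α z) := by
  refine not_congr ?_
  rw [zero_mem_resolventSet_T_iff, ← injective_iff]
  exact ⟨fun hz y hy => (isInverse_invG α).eq_zero_of_mem_resolventSet hz hy,
    (isInverse_invG α).mem_resolventSet_of_injective (isCompactOperator_invG α)⟩

end DampedWave

end

theorem proposition1 (α : ℝ) (hα : 0 < α) :
    (DampedWave.G₀ α).IsClosable ∧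
    (∃ S : ℝ≥0 → DampedWave.Hsp →L[ℂ] DampedWave.Hsp,
      DampedWave.IsContractionSemigroup S ∧ DampedWave.IsGenerator (DampedWave.G α) S) ∧
    (∀ z : ℂ, z ∈ DampedWave.opSpectrum (DampedWave.G α) ↔
      (0 : ℂ) ∈ DampedWave.opSpectrum (DampedWave.T α z)) ∧
    (∀ z ∈ DampedWave.opSpectrum (DampedWave.G α),
      DampedWave.IsDiscreteEigenvalue (DampedWave.G α) z) := by
  have h := DampedWave.isInverse_invG α
  have hC := DampedWave.isCompactOperator_invG α
  exact ⟨DampedWave.isClosable_G₀ α,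
    h.exists_contractionSemigroup hC (DampedWave.isDissipative_G hα.le),
    fun _ => DampedWave.mem_opSpectrum_G_iff, fun _ hz => h.isDiscreteEigenvalue hC hz⟩
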